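/- Let $K$ denote plain Kolmogorov complexity with respect to a fixed universal machine $U$ (a partial computable function on binary strings such that for every partial computable $M$ there is a constant $c$ with $K_U(u)\le K_M(u)+c$ for all strings $u$, where $K_M(u)=\min\{|p| : M(p)=u\}$). For $x\in\{0,1\}^\infty$ let $x(1:n)$ be its initial segment of length $n$. Two sequences $x,y\in\{0,1\}^\infty$ are called independent if $$K(x(1:n)\,y(1:m)) \ge K(x(1:n)) + K(y(1:m)) - O(\log n+\log m+1)$$ for all natural numbers $n,m$, with the convention $\log 0=0$ and a constant that may depend on $x$ and $y$. The constructive Hausdorff dimension of $x$ is the infimum of all reals $s\ge 0$ for which $\{x\}$ has effective $s$-dimensional Hausdorff measure zero, that is, for which there are uniformly recursively enumerable sets of strings $V_0,V_1,\dots$ such that for every $k$ some initial segment of $x$ belongs to $V_k$ and $\sum_{w\in V_k}2^{-s|w|}\le 2^{-k}$. A truth-table reduction $f:\{0,1\}^\infty\times\{0,1\}^\infty\to\{0,1\}^\infty$ is a map computed by a two-oracle machine that halts on all inputs and with all oracles and, on input $n$ with oracles $x$ and $y$, outputs the $n$-th bit of $f(x,y)$; a family $(f_\tau)_{\tau\in\mathbb{Q}}$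 of such maps is uniform in $\tau$ if a single two-oracle machine that halts on all inputs and with all oracles outputs, on input $(\tau,n)$ with oracles $x$ and $y$, the $n$-th bit of $f_\tau(x,y)$. Then for every real $\tau>0$ there is a truth-table reduction $f$ such that, whenever $x,y\in\{0,1\}^\infty$ are independent and both have constructive Hausdorff dimension at least $\tau$, the sequence $f(x,y)$ has constructive Hausdorff dimension $1$. Moreover, $f$ is uniform in the parameter: there is a family $(f_\tau)_{\tau\in\mathbb{Q}}$ of truth-table reductions, uniform in $\tau$, such that for every rational $\tau>0$ the map $f_\tau$ has this property. -/

import Mathlib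

open scoped ENNReal

namespace TwoSources

/-- Infinite binary sequences, with positions numbered from `0`. -/
abbrev BinSeq : Type := ℕ → Bool

/-- The initial segment of length `n` of a sequence. -/
def initSeg (x : BinSeq) (n : ℕ) : List Bool :=
  List.ofFn fun i : Fin n => x i

/-! ### Plain Kolmogorov complexity -/

/-- Plain Kolmogorov complexity of the string `u` with respect to the machine `M`, a partial
function on strings: the least length of a program on which `M` outputs `u`, and `∞` if there is
none. -/
noncomputable def complexity (M : List Bool →. List Bool) (u : List Bool) : ℕ∞ :=
  ⨅ (p : List Bool) (_ : u ∈ M p), (p.length : ℕ∞)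

/-- `U` is a universal machine for plain Kolmogorov complexity: it is partial recursive, and it is
optimal up to an additive constant among all partial recursive machines. -/
def IsUniversal (U : List Bool →. List Bool) : Prop :=
  Partrec U ∧ ∀ M : List Bool →. List Bool, Partrec M →
    ∃ c : ℕ, ∀ u : List Bool, complexity U u ≤ complexity M u + c

/-- Universal machines exist: run the machine with index `e` on `q` when given the input
`1 ^ e 0 q`. -/
theorem exists_isUniversal : ∃ U : List Bool →. List Bool, IsUniversal U := by
  let idx : List Bool → ℕ := fun p => p.findIdx fun b => !b
  have hidx : Primrec idx := Primrec.list_findIdx Primrec.id (Primrec.not.comp Primrec.snd).to₂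
  have hdrop : Primrec fun p : List Bool => p.drop (idx p + 1) :=
    Primrec.list_drop.comp (Primrec.succ.comp hidx) Primrec.id
  refine ⟨fun p => (Nat.Partrec.Code.eval (Denumerable.ofNat Nat.Partrec.Code (idx p))
      (Encodable.encode (p.drop (idx p + 1)))).bind
        fun k => ((Encodable.decode k : Option (List Bool)) : Part (List Bool)), ?_, ?_⟩
  · refine Partrec.bind ?_ ?_
    · exact Nat.Partrec.Code.eval_part.comp
        ((Primrec.ofNat Nat.Partrec.Code).comp hidx).to_comp
        (Primrec.encode.comp hdrop).to_comp
    · exact (Computable.ofOption (Computable.decode.comp Computable.snd)).to₂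
  · intro M hM
    obtain ⟨c, hc⟩ := Nat.Partrec.Code.exists_code.1 hM
    refine ⟨Encodable.encode c + 1, fun u => ?_⟩
    unfold complexity
    rw [ENat.iInf_add]
    refine le_iInf fun p => ?_
    by_cases hp : u ∈ M p
    · simp only [hp, iInf_pos]
      refine iInf₂_le_of_le
        (List.replicate (Encodable.encode c) true ++ false :: p) ?_ ?_
      · have h1 : idx (List.replicate (Encodable.encode c) true ++ false :: p)
            = Encodable.encode c := by
          have h0 : (List.replicate (Encodable.encode c) true).findIdx (fun b => !b)
              = Encodable.encode c := by
            simpa using List.findIdx_eq_length_of_false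
              (xs := List.replicate (Encodable.encode c) true) (p := fun b => !b)
              (by simp)
          simp [idx, List.findIdx_append, List.findIdx_cons, h0]
        simp [h1, hc, hp, List.drop_append]
      · simp only [List.length_append, List.length_replicate, List.length_cons]
        push_cast
        apply le_of_eq
        ring
    · simp [hp]

/-! ### Independence -/

/-- Independence of two sequences (with respect to the universal machine `U`): for all `n, m`,
`K(x(1:n)) + K(y(1:m)) ≤ K(x(1:n) y(1:m)) + O(log n + log m)`. The additional `1` makes the
asymptotic bound meaningful also for `n, m ≤ 1`. -/
def Independent (U : List Bool →. List Bool) (x y : BinSeq) : Prop :=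
  ∃ C : ℕ, ∀ n m : ℕ,
    complexity U (initSeg x n) + complexity U (initSeg y m)
      ≤ complexity U (initSeg x n ++ initSeg y m) + (C * (Nat.log 2 n + Nat.log 2 m + 1) : ℕ)

/-! ### Constructive Hausdorff dimension -/

/-- The singleton `{x}` has effective `s`-dimensional Hausdorff measure zero: there is a uniformly
recursively enumerable sequence of sets of strings `V k`, each containing an initial segment of `x`,
such that `∑_{w ∈ V k} 2 ^ (-s |w|) ≤ 2 ^ (-k)`. -/
def EffectivelyNull (s : ℝ) (x : BinSeq) : Prop :=
  ∃ V : ℕ → Set (List Bool),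
    REPred (fun a : ℕ × List Bool => a.2 ∈ V a.1) ∧
    ∀ k : ℕ,
      (∃ n : ℕ, initSeg x n ∈ V k) ∧
      ∑' w : V k, (2 : ℝ≥0∞) ^ (-s * ((w : List Bool).length : ℝ)) ≤ (2 : ℝ≥0∞) ^ (-(k : ℝ))

/-- The constructive Hausdorff dimension of a sequence `x`: the infimum of the `s ≥ 0` for which
`{x}` has effective `s`-dimensional Hausdorff measure zero. -/
noncomputable def constructiveDim (x : BinSeq) : ℝ :=
  sInf {s : ℝ | 0 ≤ s ∧ EffectivelyNull s x}

/-! ### Oracle machines and truth-table reductions -/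

/-- Programs with access to two oracles: codes for partial recursive functions, as in
`Nat.Partrec.Code`, with two further instructions that query the first and the second oracle. -/
inductive OracleCode : Type
  | zero : OracleCode
  | succ : OracleCode
  | left : OracleCode
  | right : OracleCode
  | query₁ : OracleCode
  | query₂ : OracleCode
  | pair : OracleCode → OracleCode → OracleCode
  | comp : OracleCode → OracleCode → OracleCode
  | prec : OracleCode → OracleCode → OracleCode
  | rfind' : OracleCode → OracleCode

/-- The partial function computed by a program that works with oracles `x` and `y`. On input `n` the
query instructions return the `n`-th bit of the oracle; all others are as in
`Nat.Partrec.Code.eval`. -/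
def OracleCode.eval (x y : BinSeq) : OracleCode → ℕ →. ℕ
  | zero => pure 0
  | succ => Nat.succ
  | left => ↑fun n : ℕ => n.unpair.1
  | right => ↑fun n : ℕ => n.unpair.2
  | query₁ => ↑fun n : ℕ => (x n).toNat
  | query₂ => ↑fun n : ℕ => (y n).toNat
  | pair cf cg => fun n => Nat.pair <$> eval x y cf n <*> eval x y cg n
  | comp cf cg => fun n => eval x y cg n >>= eval x y cf
  | prec cf cg =>
    Nat.unpaired fun a n =>
      n.rec (eval x y cf a) fun k IH => do
        let i ← IH
        eval x y cg (Nat.pair a (Nat.pair k i))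
  | rfind' cf =>
    Nat.unpaired fun a m =>
      (Nat.rfind fun n => (fun m => m = 0) <$> eval x y cf (Nat.pair a (n + m))).map (· + m)

/-- The program halts on all inputs and with all oracles. -/
def OracleCode.IsTotal (M : OracleCode) : Prop :=
  ∀ (x y : BinSeq) (k : ℕ), (M.eval x y k).Dom

/-- `f` is a truth-table reduction: some oracle program that halts on all inputs and with all oracles
outputs, on input `n` and with oracles `x` and `y`, the `n`-th bit of `f x y`. -/
def IsTruthTableReduction (f : BinSeq → BinSeq → BinSeq) : Prop :=
  ∃ M : OracleCode, M.IsTotal ∧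
    ∀ (x y : BinSeq) (n : ℕ), (f x y n).toNat ∈ M.eval x y n

/-- `f` is a truth-table reduction uniform in a rational parameter `τ`: some oracle program that halts
on all inputs and with all oracles outputs, on input `(τ, n)` and with oracles `x` and `y`, the
`n`-th bit of `f τ x y`. The rational `τ` is given by its numerator and denominator in lowest
terms. -/
def IsUniformTruthTableReduction (f : ℚ → BinSeq → BinSeq → BinSeq) : Prop :=
  ∃ M : OracleCode, M.IsTotal ∧
    ∀ (τ : ℚ) (x y : BinSeq) (n : ℕ),
      (f τ x y n).toNat ∈ M.eval x y (Encodable.encode (τ.num, τ.den, n))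

end TwoSources

/-! One reduction serves every positive dimension, so the uniform family is constant. The output is
cut into blocks. Block `i` starts at position `2 ^ (i * i) - 1`, and it is the value of a function
`E i` at the initial segments of `x` and `y` of length `2 ^ ((i + 1) * (i + 1) + i)`. The input of a
block is thus at least `2 ^ i` times as long as the block. A sequence of positive dimension
satisfies `n ≤ c * K(x(1:n))` for some `c` and all large `n` (`exists_le_mul_complexity`). Whatever
`c` is, each source therefore eventually supplies far more complexity than the length of the block
plus the length of input read by all earlier blocks (`entropy_le_two_pow`).

The functions `E i` are nearly balanced: on every rectangle `X ×ˢ Y` each value is taken about as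
often as it should be, up to a small additive error. A random function has this property by an
exponential moment bound and a union bound (`exists_balanced_fintype`). It is decidable for finite
tables, so such functions are found by search (`exists_isComputable_isBalanced`).

Let a block lie in a set of density `2 ^ (-g)` that is enumerable from the preceding blocks. The
preceding blocks depend only on short initial segments of the inputs, that is, on residues of their
codes. Balance on the subrectangles with fixed residues shows that at most `2 ^ (kx + ky + 5 - g)`
pairs of complexity at most `kx` and `ky` have such a value (`IsBalanced.card_filter_mem_mul_le`).
The actual pair is described by its rank in an enumeration of them, so its joint complexity is about
`kx + ky - g` (`exists_complexity_append_add_le`). Independence then bounds `g` by `O(log)` of the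
parameters (`exists_density_le`).

Now suppose that the output `z` is effectively `s`-null with `s < 1`. Arbitrarily long initial
segments of `z` lie in enumerable sets that contain at most a fraction `2 ^ (-(n / d))` of the
strings of their length `n` (`EffectivelyNull.exists_sparse`). Cut such a segment where its last,
possibly incomplete, block starts, and let `g` be about `n / (2 * d)`. If the section of the set
above the first part has density at most `2 ^ (-g)`, the last block lies in a sparse set. Otherwise
the first part is one of the few strings with a dense section (`card_dense_section_mul_le`), and
then the block before the last one lies in a set of density about `2 ^ (-g)`, up to a factor for the
still earlier blocks, which are negligibly short. In both cases the drop in complexity is linear in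
`n`, while independence permits only a logarithmic one (`not_effectivelyNull_extract`). -/

namespace TwoSources

/-! ### Computable functions -/

/-- `Computable`, as a structure, so that `fun_prop` does not unfold it. -/
@[fun_prop]
structure IsComputable {α σ : Type*} [Primcodable α] [Primcodable σ] (f : α → σ) : Prop where
  out : Computable f

section
variable {α β γ σ : Type*} [Primcodable α] [Primcodable β] [Primcodable γ] [Primcodable σ]

@[fun_prop]
theorem isComputable_id : IsComputable (fun a : α => a) :=
  ⟨Computable.id⟩

@[fun_prop]
theorem isComputable_const (s : σ) : IsComputable (fun _ : α => s) :=
  ⟨Computable.const s⟩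

@[fun_prop]
theorem isComputable_comp {g : β → γ} {f : α → β} (hg : IsComputable g) (hf : IsComputable f) :
    IsComputable (fun a => g (f a)) :=
  ⟨hg.out.comp hf.out⟩

@[fun_prop]
theorem isComputable_prodMk {f : α → β} {g : α → γ} (hf : IsComputable f)
    (hg : IsComputable g) : IsComputable (fun a => (f a, g a)) :=
  ⟨hf.out.pair hg.out⟩

@[fun_prop]
theorem isComputable_fst {f : α → β × γ} (hf : IsComputable f) :
    IsComputable (fun a => (f a).1) :=
  ⟨Computable.fst.comp hf.out⟩

@[fun_prop]
theorem isComputable_snd {f : α → β × γ} (hf : IsComputable f) :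
    IsComputable (fun a => (f a).2) :=
  ⟨Computable.snd.comp hf.out⟩

@[fun_prop]
theorem isComputable_add {f g : α → ℕ} (hf : IsComputable f) (hg : IsComputable g) :
    IsComputable (fun a => f a + g a) :=
  ⟨Primrec.nat_add.to_comp.comp hf.out hg.out⟩

@[fun_prop]
theorem isComputable_mul {f g : α → ℕ} (hf : IsComputable f) (hg : IsComputable g) :
    IsComputable (fun a => f a * g a) :=
  ⟨Primrec.nat_mul.to_comp.comp hf.out hg.out⟩

@[fun_prop]
theorem isComputable_sub {f g : α → ℕ} (hf : IsComputable f) (hg : IsComputable g) :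
    IsComputable (fun a => f a - g a) :=
  ⟨Primrec.nat_sub.to_comp.comp hf.out hg.out⟩

@[fun_prop]
theorem isComputable_div {f g : α → ℕ} (hf : IsComputable f) (hg : IsComputable g) :
    IsComputable (fun a => f a / g a) :=
  ⟨Primrec.nat_div.to_comp.comp hf.out hg.out⟩

@[fun_prop]
theorem isComputable_mod {f g : α → ℕ} (hf : IsComputable f) (hg : IsComputable g) :
    IsComputable (fun a => f a % g a) :=
  ⟨Primrec.nat_mod.to_comp.comp hf.out hg.out⟩

@[fun_prop]
theorem isComputable_pow {f g : α → ℕ} (hf : IsComputable f) (hg : IsComputable g) :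
    IsComputable (fun a => f a ^ g a) :=
  ⟨(Primrec₂.unpaired'.1 Nat.Primrec.pow).to_comp.comp hf.out hg.out⟩

@[fun_prop]
theorem isComputable_and {f g : α → Bool} (hf : IsComputable f) (hg : IsComputable g) :
    IsComputable (fun a => f a && g a) :=
  ⟨Primrec.and.to_comp.comp hf.out hg.out⟩

@[fun_prop]
theorem isComputable_or {f g : α → Bool} (hf : IsComputable f) (hg : IsComputable g) :
    IsComputable (fun a => f a || g a) :=
  ⟨Primrec.or.to_comp.comp hf.out hg.out⟩

@[fun_prop]
theorem isComputable_not {f : α → Bool} (hf : IsComputable f) :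
    IsComputable (fun a => !f a) :=
  ⟨Primrec.not.to_comp.comp hf.out⟩

@[fun_prop]
theorem isComputable_decide_le {f g : α → ℕ} (hf : IsComputable f) (hg : IsComputable g) :
    IsComputable (fun a => decide (f a ≤ g a)) :=
  ⟨Primrec.nat_le.decide.to_comp.comp hf.out hg.out⟩

@[fun_prop]
theorem isComputable_decide_lt {f g : α → ℕ} (hf : IsComputable f) (hg : IsComputable g) :
    IsComputable (fun a => decide (f a < g a)) :=
  ⟨Primrec.nat_lt.decide.to_comp.comp hf.out hg.out⟩

@[fun_prop]
theorem isComputable_decide_eq [DecidableEq β] {f g : α → β} (hf : IsComputable f)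
    (hg : IsComputable g) :
    IsComputable (fun a => decide (f a = g a)) :=
  ⟨Primrec.eq.decide.to_comp.comp hf.out hg.out⟩

@[fun_prop]
theorem isComputable_cond {f : α → Bool} {g h : α → β} (hf : IsComputable f)
    (hg : IsComputable g) (hh : IsComputable h) :
    IsComputable (fun a => bif f a then g a else h a) :=
  ⟨hf.out.cond hg.out hh.out⟩

@[fun_prop]
theorem isComputable_natRec {f : α → ℕ} {g : α → σ} {h : α → ℕ → σ → σ}
    (hf : IsComputable f) (hg : IsComputable g)
    (hh : IsComputable fun p : α × ℕ × σ => h p.1 p.2.1 p.2.2) :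
    IsComputable (fun a => Nat.rec (motive := fun _ => σ) (g a) (h a) (f a)) :=
  ⟨Computable.nat_rec (h := fun a p => h a p.1 p.2) hf.out hg.out hh.out.to₂⟩

@[fun_prop]
theorem isComputable_count {f : α → ℕ} {p : α → ℕ → Bool}
    (hf : IsComputable f) (hp : IsComputable fun a : α × ℕ => p a.1 a.2) :
    IsComputable (fun a => Nat.count (fun k => p a k = true) (f a)) := by
  have h : IsComputable (fun a => Nat.rec (motive := fun _ => ℕ) 0
      (fun k c => c + bif p a k then 1 else 0) (f a)) := by
    refine isComputable_natRec hf (by fun_prop) ?_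
    fun_prop
  refine ⟨h.out.of_eq fun a => ?_⟩
  induction f a with
  | zero => simp
  | succ k ih => simp only [ih, Nat.count_succ]; cases p a k <;> simp

@[fun_prop]
theorem isComputable_unpair {f : α → ℕ} (hf : IsComputable f) :
    IsComputable (fun a => (f a).unpair) := ⟨Computable.unpair.comp hf.out⟩

@[fun_prop]
theorem isComputable_pair {f g : α → ℕ} (hf : IsComputable f) (hg : IsComputable g) :
    IsComputable (fun a => Nat.pair (f a) (g a)) := ⟨Primrec₂.natPair.to_comp.comp hf.out hg.out⟩
/-- The element with a given code, or the default element if there is none. -/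
def decodeD (β : Type*) [Primcodable β] [Inhabited β] (n : ℕ) : β :=
  (Encodable.decode n : Option β).getD default

@[simp]
theorem decodeD_encode [Inhabited β] (b : β) : decodeD β (Encodable.encode b) = b := by
  simp [decodeD]

@[fun_prop]
theorem isComputable_decodeD [Inhabited β] {f : α → ℕ}
    (hf : IsComputable f) : IsComputable (fun a => decodeD β (f a)) :=
  ⟨Computable.option_getD (Computable.decode.comp hf.out) (Computable.const _)⟩

@[fun_prop]
theorem isComputable_encode {f : α → β} (hf : IsComputable f) :
    IsComputable (fun a => Encodable.encode (f a)) := ⟨Computable.encode.comp hf.out⟩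

@[fun_prop]
theorem isComputable_append {f g : α → List β} (hf : IsComputable f)
    (hg : IsComputable g) : IsComputable (fun a => f a ++ g a) :=
  ⟨Computable.list_append.comp hf.out hg.out⟩

@[fun_prop]
theorem isComputable_cons {f : α → β} {g : α → List β} (hf : IsComputable f)
    (hg : IsComputable g) : IsComputable (fun a => f a :: g a) :=
  ⟨Computable.list_cons.comp hf.out hg.out⟩

@[fun_prop]
theorem isComputable_length {f : α → List β} (hf : IsComputable f) :
    IsComputable (fun a => (f a).length) := ⟨Computable.list_length.comp hf.out⟩

@[fun_prop]
theorem isComputable_drop {f : α → ℕ} {g : α → List β} (hf : IsComputable f)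
    (hg : IsComputable g) : IsComputable (fun a => (g a).drop (f a)) :=
  ⟨Primrec.list_drop.to_comp.comp hf.out hg.out⟩

@[fun_prop]
theorem isComputable_take {f : α → ℕ} {g : α → List β} (hf : IsComputable f)
    (hg : IsComputable g) : IsComputable (fun a => (g a).take (f a)) :=
  ⟨Primrec.list_take.to_comp.comp hf.out hg.out⟩

@[fun_prop]
theorem isComputable_getD {f : α → ℕ} {g : α → List β} (d : β) (hf : IsComputable f)
    (hg : IsComputable g) : IsComputable (fun a => (g a).getD (f a) d) :=
  ⟨(Primrec.list_getD d).to_comp.comp hg.out hf.out⟩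

@[fun_prop]
theorem isComputable_toNat {f : α → Bool} (hf : IsComputable f) :
    IsComputable (fun a => (f a).toNat) :=
  ⟨(Primrec.dom_finite Bool.toNat).to_comp.comp hf.out⟩

@[fun_prop]
theorem isComputable_isSome {f : α → Option β} (hf : IsComputable f) :
    IsComputable (fun a => (f a).isSome) :=
  ⟨Primrec.option_isSome.to_comp.comp hf.out⟩

@[fun_prop]
theorem isComputable_testBit {f g : α → ℕ} (hf : IsComputable f)
    (hg : IsComputable g) : IsComputable (fun a => (f a).testBit (g a)) := by
  have h : IsComputable (fun a => decide (f a / 2 ^ g a % 2 = 1)) := by fun_prop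
  exact ⟨h.out.of_eq fun a => by rw [Nat.testBit_eq_decide_div_mod_eq]⟩

theorem initSeg_succ (x : BinSeq) (n : ℕ) : initSeg x (n + 1) = initSeg x n ++ [x n] := by
  unfold initSeg; rw [List.ofFn_succ_last]; rfl

@[fun_prop]
theorem isComputable_initSeg {f : α → ℕ} {x : α → ℕ → Bool} (hf : IsComputable f)
    (hx : IsComputable fun a : α × ℕ => x a.1 a.2) :
    IsComputable (fun a => initSeg (x a) (f a)) := by
  have h : IsComputable (fun a => Nat.rec (motive := fun _ => List Bool) []
      (fun k l => l ++ [x a k]) (f a)) := by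
    refine isComputable_natRec hf (by fun_prop) ?_
    fun_prop
  refine ⟨h.out.of_eq fun a => ?_⟩
  induction f a with
  | zero => simp [initSeg]
  | succ k ih => simp only [ih, initSeg_succ]

@[fun_prop]
theorem isComputable_sum {f : α → ℕ} {p : α → ℕ → ℕ}
    (hf : IsComputable f) (hp : IsComputable fun a : α × ℕ => p a.1 a.2) :
    IsComputable (fun a => ∑ k ∈ Finset.range (f a), p a k) := by
  have h : IsComputable (fun a => Nat.rec (motive := fun _ => ℕ) 0
      (fun k c => c + p a k) (f a)) := by
    refine isComputable_natRec hf (by fun_prop) ?_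
    fun_prop
  refine ⟨h.out.of_eq fun a => ?_⟩
  induction f a with
  | zero => simp
  | succ k ih => simp only [ih, Finset.sum_range_succ]

/-! ### Recursively enumerable predicates by stages -/

/-- The stage is the step bound of `evaln`. Monotonicity in the stage makes "first appears at stage
`s`" and "has appeared before" meaningful in the counting arguments. -/
theorem exists_stage {P : α → Prop} (h : REPred P) :
    ∃ T : α × ℕ → Bool, IsComputable T ∧ (∀ a s s', s ≤ s' → T (a, s) → T (a, s')) ∧
      ∀ a, P a ↔ ∃ s, T (a, s) := by
  obtain ⟨c, hc⟩ := Nat.Partrec.Code.exists_code.1 h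
  refine ⟨fun a => (Nat.Partrec.Code.evaln a.2 c (Encodable.encode a.1)).isSome,
    isComputable_isSome ⟨Nat.Partrec.Code.primrec_evaln.to_comp.comp
      ((Computable.snd.pair (Computable.const c)).pair
        (Computable.encode.comp Computable.fst))⟩, ?_, ?_⟩
  · intro a s s' hs h1
    rw [Option.isSome_iff_exists] at h1 ⊢
    obtain ⟨v, hv⟩ := h1
    exact ⟨v, Nat.Partrec.Code.evaln_mono hs hv⟩
  · intro a
    have h1 : P a ↔ (Nat.Partrec.Code.eval c (Encodable.encode a)).Dom := by
      rw [hc]; simp [Part.assert, Part.bind]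
    rw [h1, Part.dom_iff_mem]
    simp only [Nat.Partrec.Code.evaln_complete, Option.isSome_iff_exists]
    exact exists_comm

theorem rePred_exists_stage {T : α × ℕ → Bool} (hT : IsComputable T) :
    REPred fun a => ∃ s, T (a, s) := by
  have h : Partrec fun a => Nat.rfind fun s => Part.some (T (a, s)) :=
    Partrec.rfind (p := fun a s => Part.some (T (a, s))) hT.out.partrec.to₂
  refine h.dom_re.of_eq fun a => ?_
  refine Nat.rfind_dom.trans ⟨?_, ?_⟩
  · rintro ⟨s, hs, -⟩
    exact ⟨s, (Part.mem_some_iff.1 hs).symm⟩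
  · rintro ⟨s, hs⟩
    exact ⟨s, Part.mem_some_iff.2 hs.symm, fun _ => trivial⟩

theorem rePred_of_isComputable {T : α → Bool} (hT : IsComputable T) : REPred fun a => T a := by
  refine (rePred_exists_stage (T := fun a => T a.1) (by fun_prop)).of_eq fun a => by simp

theorem rePred_comp {P : β → Prop} (hP : REPred P) {f : α → β} (hf : IsComputable f) :
    REPred fun a => P (f a) := by
  exact Partrec.comp hP hf.out

theorem rePred_and {P Q : α → Prop} (hP : REPred P) (hQ : REPred Q) :
    REPred fun a => P a ∧ Q a := by
  obtain ⟨S, hS, hSm, hSP⟩ := exists_stage hP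
  obtain ⟨T, hT, hTm, hTQ⟩ := exists_stage hQ
  refine (rePred_exists_stage (T := fun a => S a && T a) (by fun_prop)).of_eq fun a => ?_
  simp only [Bool.and_eq_true, hSP, hTQ]
  constructor
  · rintro ⟨s, h1, h2⟩; exact ⟨⟨s, h1⟩, ⟨s, h2⟩⟩
  · rintro ⟨⟨s, h1⟩, ⟨t, h2⟩⟩
    exact ⟨max s t, hSm _ _ _ (le_max_left _ _) h1, hTm _ _ _ (le_max_right _ _) h2⟩

theorem rePred_exists [Inhabited β] {P : α × β → Prop} (hP : REPred P) :
    REPred fun a => ∃ b, P (a, b) := by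
  obtain ⟨S, hS, hSm, hSP⟩ := exists_stage hP
  refine (rePred_exists_stage
    (T := fun a => S ((a.1, decodeD β a.2.unpair.1), a.2.unpair.2))
    (by fun_prop)).of_eq fun a => ?_
  simp only [hSP]
  constructor
  · rintro ⟨s, h⟩; exact ⟨_, _, h⟩
  · rintro ⟨b, s, h⟩; exact ⟨Nat.pair (Encodable.encode b) s, by simpa using h⟩

theorem rePred_graph [DecidableEq β] {f : α →. β} (hf : Partrec f) :
    REPred fun a : α × β => a.2 ∈ f a.1 := by
  have h : Partrec fun a : α × β => (f a.1).bind fun b =>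
      ((if a.2 = b then some () else none : Option Unit) : Part Unit) := by
    refine Partrec.bind (hf.comp Computable.fst) ?_
    refine (Computable.ofOption
      (f := fun a : (α × β) × β => if a.1.2 = a.2 then some () else none) ?_).to₂
    exact (Primrec.ite (Primrec.eq.comp (Primrec.snd.comp Primrec.fst) Primrec.snd)
      (Primrec.const _) (Primrec.const _)).to_comp
  refine h.dom_re.of_eq fun a => ?_
  rw [Part.dom_iff_mem]
  constructor
  · rintro ⟨_, h⟩
    obtain ⟨b, hb, h⟩ := Part.mem_bind_iff.1 h
    split_ifs at h with h1
    · rwa [h1]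
    · simp at h
  · intro h
    exact ⟨(), Part.mem_bind_iff.2 ⟨a.2, h, by simp⟩⟩

end

/-! ### Binary codes of initial segments -/

/-- The number whose binary digits, the least significant one first, are `x 0, …, x (n - 1)`. -/
def prefixCode (x : ℕ → Bool) (n : ℕ) : ℕ := ∑ p ∈ Finset.range n, (x p).toNat * 2 ^ p

theorem prefixCode_succ (x : ℕ → Bool) (n : ℕ) :
    prefixCode x (n + 1) = prefixCode x n + (x n).toNat * 2 ^ n := Finset.sum_range_succ _ _

@[fun_prop]
theorem isComputable_prefixCode {α : Type*} [Primcodable α] {f : α → ℕ}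
    {x : α → ℕ → Bool} (hf : IsComputable f) (hx : IsComputable fun a : α × ℕ => x a.1 a.2) :
    IsComputable (fun a => prefixCode (x a) (f a)) := by
  unfold prefixCode
  fun_prop

theorem prefixCode_lt (x : ℕ → Bool) (n : ℕ) : prefixCode x n < 2 ^ n := by
  induction n with
  | zero => simp [prefixCode]
  | succ n ih =>
    rw [prefixCode_succ, pow_succ]
    cases x n <;> simp <;> omega

theorem testBit_prefixCode (x : ℕ → Bool) (n p : ℕ) :
    (prefixCode x n).testBit p = (decide (p < n) && x p) := by
  induction n with
  | zero => simp [prefixCode]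
  | succ n ih =>
    have h : prefixCode x (n + 1) = 2 ^ n * (x n).toNat + prefixCode x n := by
      rw [prefixCode_succ]; ring
    rw [h, Nat.testBit_two_pow_mul_add _ (prefixCode_lt x n), ih]
    split_ifs with h1
    · simp [h1, h1.trans n.lt_succ_self]
    · rcases Nat.eq_or_lt_of_le (not_lt.1 h1) with h2 | h2
      · subst h2; cases x n <;> simp
      · have h3 : ¬ p < n + 1 := by omega
        obtain ⟨d, rfl⟩ := Nat.exists_eq_add_of_lt h2
        have h4 : n + d + 1 - n = d + 1 := by omega
        cases x n <;> simp [h3, h4, Nat.testBit_succ]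

theorem prefixCode_testBit (u n : ℕ) : prefixCode u.testBit n = u % 2 ^ n := by
  refine Nat.eq_of_testBit_eq fun p => ?_
  rw [testBit_prefixCode, Nat.testBit_mod_two_pow]

theorem prefixCode_mod (x : ℕ → Bool) {j n : ℕ} (h : j ≤ n) :
    prefixCode x n % 2 ^ j = prefixCode x j := by
  refine Nat.eq_of_testBit_eq fun p => ?_
  rw [testBit_prefixCode, Nat.testBit_mod_two_pow, testBit_prefixCode]
  by_cases hp : p < j
  · simp [hp, hp.trans_le h]
  · simp [hp]

theorem prefixCode_congr {x y : ℕ → Bool} {n : ℕ} (h : ∀ p < n, x p = y p) :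
    prefixCode x n = prefixCode y n :=
  Finset.sum_congr rfl fun p hp => by rw [h p (Finset.mem_range.1 hp)]

theorem initSeg_congr {x y : ℕ → Bool} {n : ℕ} (h : ∀ p < n, x p = y p) :
    initSeg x n = initSeg y n := by
  unfold initSeg
  exact congrArg _ (funext fun i => h i i.2)

@[simp]
theorem length_initSeg (x : ℕ → Bool) (n : ℕ) : (initSeg x n).length = n := by
  simp [initSeg]

theorem getD_initSeg (x : ℕ → Bool) (n : ℕ) {p : ℕ} (hp : p < n) :
    (initSeg x n).getD p false = x p := by
  simp [initSeg, hp]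

theorem initSeg_prefixCode (x : ℕ → Bool) (n : ℕ) :
    initSeg (prefixCode x n).testBit n = initSeg x n :=
  initSeg_congr fun p hp => by simp [testBit_prefixCode, hp]

/-- The number with the given binary digits, the least significant one first. -/
def listCode (l : List Bool) : ℕ := prefixCode (fun p => l.getD p false) l.length

theorem listCode_initSeg (x : ℕ → Bool) (n : ℕ) : listCode (initSeg x n) = prefixCode x n := by
  unfold listCode
  rw [length_initSeg]
  exact prefixCode_congr fun p hp => getD_initSeg x n hp

theorem initSeg_listCode (l : List Bool) : initSeg (listCode l).testBit l.length = l := by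
  unfold listCode
  rw [initSeg_prefixCode]
  refine List.ext_getElem (by simp) fun p h1 h2 => ?_
  simp [initSeg]

theorem listCode_lt (l : List Bool) : listCode l < 2 ^ l.length := prefixCode_lt _ _

@[fun_prop]
theorem isComputable_listCode {α : Type*} [Primcodable α] {f : α → List Bool}
    (hf : IsComputable f) : IsComputable (fun a => listCode (f a)) := by
  unfold listCode
  fun_prop

/-! ### Plain Kolmogorov complexity -/

theorem complexity_le_of_mem {M : List Bool →. List Bool} {p u : List Bool} (h : u ∈ M p) :
    complexity M u ≤ p.length := iInf₂_le p h

theorem complexity_le_iff {M : List Bool →. List Bool} {u : List Bool} {k : ℕ} :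
    complexity M u ≤ k ↔ ∃ p : List Bool, p.length ≤ k ∧ u ∈ M p := by
  constructor
  · intro h
    have h1 : complexity M u < (k + 1 : ℕ) :=
      h.trans_lt (by exact_mod_cast Nat.lt_succ_self k)
    unfold complexity at h1
    simp only [iInf_lt_iff] at h1
    obtain ⟨p, hp, h2⟩ := h1
    exact ⟨p, Nat.lt_succ_iff.1 (by exact_mod_cast h2), hp⟩
  · rintro ⟨p, hp, h⟩
    exact (complexity_le_of_mem h).trans (by exact_mod_cast hp)

theorem rePred_complexity_le {M : List Bool →. List Bool} (hM : Partrec M) :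
    REPred fun a : ℕ × List Bool => complexity M a.2 ≤ a.1 := by
  have h1 : REPred fun a : (ℕ × List Bool) × List Bool =>
      decide (a.2.length ≤ a.1.1) = true ∧ a.1.2 ∈ M a.2 :=
    rePred_and (P := fun a : (ℕ × List Bool) × List Bool => decide (a.2.length ≤ a.1.1) = true)
      (Q := fun a => a.1.2 ∈ M a.2) (rePred_of_isComputable (by fun_prop))
      (rePred_comp (rePred_graph hM) (f := fun a : (ℕ × List Bool) × List Bool => (a.2, a.1.2))
        (by fun_prop))
  refine (rePred_exists h1).of_eq fun a => ?_
  simp [complexity_le_iff]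

theorem exists_complexity_le_length_add {U : List Bool →. List Bool} (hU : IsUniversal U) :
    ∃ c : ℕ, ∀ u, complexity U u ≤ (u.length + c : ℕ) := by
  obtain ⟨c, hc⟩ := hU.2 (fun p => Part.some p) Partrec.some
  refine ⟨c, fun u => (hc u).trans ?_⟩
  push_cast
  gcongr
  exact complexity_le_of_mem (Part.mem_some u)

/-- Programs of length at most `k` correspond to numbers below `2 ^ (k + 1)`: a leading digit `1`
marks the length, and the digits below it are the program. -/
theorem exists_finset_complexity_le (M : List Bool →. List Bool) (k : ℕ) :
    ∃ F : Finset (List Bool), (∀ u, complexity M u ≤ k → u ∈ F) ∧ F.card ≤ 2 ^ (k + 1) := by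
  classical
  let out : ℕ → List Bool := fun N =>
    if h : ∃ u, u ∈ M (initSeg N.testBit (Nat.log 2 N)) then h.choose else []
  refine ⟨(Finset.range (2 ^ (k + 1))).image out, fun u hu => ?_,
    Finset.card_image_le.trans (by simp)⟩
  obtain ⟨p, hp, h⟩ := complexity_le_iff.1 hu
  have h1 : ∃ N < 2 ^ (k + 1), initSeg N.testBit (Nat.log 2 N) = p := by
    have h3 := listCode_lt p
    have h4 : 2 ^ p.length ≤ 2 ^ k := Nat.pow_le_pow_right two_pos hp
    refine ⟨2 ^ p.length * 1 + listCode p, by rw [pow_succ]; omega, ?_⟩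
    have h2 : Nat.log 2 (2 ^ p.length * 1 + listCode p) = p.length := by
      refine (Nat.log_eq_iff (Or.inr ⟨by norm_num, by positivity⟩)).2 ⟨by omega, ?_⟩
      rw [pow_succ]; omega
    rw [h2]
    conv_rhs => rw [← initSeg_listCode p]
    refine initSeg_congr fun i hi => ?_
    rw [Nat.testBit_two_pow_mul_add _ h3, if_pos hi]
  obtain ⟨N, hN, h2⟩ := h1
  refine Finset.mem_image.2 ⟨N, Finset.mem_range.2 hN, ?_⟩
  have h3 : ∃ u, u ∈ M (initSeg N.testBit (Nat.log 2 N)) := ⟨u, by rwa [h2]⟩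
  have h4 : out N = h3.choose := dif_pos h3
  have h5 := h3.choose_spec
  rw [← h4, h2] at h5
  exact Part.mem_unique h5 h

/-- A string of a small set out of a recursively enumerable family has small complexity. -/
theorem exists_complexity_le_of_card_le {U : List Bool →. List Bool} (hU : IsUniversal U)
    {S : ℕ × List Bool → Prop} (hS : REPred S) :
    ∃ c : ℕ, ∀ (q : ℕ) (w : List Bool) (g h : ℕ) (F : Finset (List Bool)), S (q, w) →
      (∀ v, S (q, v) → v ∈ F) → F.card * 2 ^ g ≤ 2 ^ h →
      complexity U w + g ≤ (h + 2 * Nat.size q + c : ℕ) := by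
  obtain ⟨T, hT, hTm, hTS⟩ := exists_stage hS
  -- `D (q, m)` holds if `m` codes a string together with the first stage at which it appears. The
  -- final test discards numbers that decode only to the default string, so that each string is
  -- listed exactly once.
  let D : ℕ × ℕ → Bool := fun a =>
    T ((a.1, decodeD (List Bool) a.2.unpair.1), a.2.unpair.2) &&
      (decide (a.2.unpair.2 = 0) ||
        !T ((a.1, decodeD (List Bool) a.2.unpair.1), a.2.unpair.2 - 1)) &&
      decide (Encodable.encode (decodeD (List Bool) a.2.unpair.1) = a.2.unpair.1)
  have hD : IsComputable D := by unfold D; fun_prop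
  let idx : List Bool → ℕ := fun p => p.findIdx fun b => !b
  have hidx : IsComputable idx :=
    ⟨(Primrec.list_findIdx Primrec.id (Primrec.not.comp Primrec.snd).to₂).to_comp⟩
  -- A program `1 ^ l 0 a b` with `|a| = l` is read as the parameter `a` and the rank `b`. The
  -- self-delimiting form of `a` accounts for the `2 * Nat.size q`; the rank needs only `h - g`
  -- bits.
  let Q : List Bool → ℕ := fun p => listCode ((p.drop (idx p + 1)).take (idx p))
  let t : List Bool → ℕ := fun p => listCode ((p.drop (idx p + 1)).drop (idx p))
  have hQ : IsComputable Q := by unfold Q; fun_prop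
  have ht : IsComputable t := by unfold t; fun_prop
  let B : List Bool × ℕ → Bool := fun a =>
    D (Q a.1, a.2) && decide (Nat.count (fun k => D (Q a.1, k) = true) a.2 = t a.1)
  have hB : IsComputable B := by unfold B; fun_prop
  let M : List Bool →. List Bool := fun p =>
    (Nat.rfind fun m => Part.some (B (p, m))).map
      fun m => decodeD (List Bool) m.unpair.1
  have hM : Partrec M := by
    refine Partrec.map (Partrec.rfind (p := fun p m => Part.some (B (p, m))) hB.out.partrec.to₂)
      ?_
    exact (isComputable_decodeD (β := List Bool) (f := fun a : List Bool × ℕ => a.2.unpair.1)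
      (by fun_prop)).out.to₂
  obtain ⟨c, hc⟩ := hU.2 M hM
  refine ⟨c + 1, fun q w g h F hw hF hcard => ?_⟩
  -- the position of `w` in the enumeration
  obtain ⟨m, hm, hmw⟩ : ∃ m, D (q, m) = true ∧ decodeD (List Bool) m.unpair.1 = w := by
    have h1 := (hTS _).1 hw
    classical
    refine ⟨Nat.pair (Encodable.encode w) (Nat.find h1), ?_, by simp⟩
    have h2 := Nat.find_spec h1
    have h3 : Nat.find h1 = 0 ∨ T ((q, w), Nat.find h1 - 1) = false := by
      by_cases h0 : Nat.find h1 = 0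
      · exact Or.inl h0
      · exact Or.inr (by simpa using Nat.find_min h1 (m := Nat.find h1 - 1) (by omega))
    simp only [D, Nat.unpair_pair, decodeD_encode, Bool.and_eq_true, Bool.or_eq_true,
      decide_eq_true_eq, Bool.not_eq_true']
    exact ⟨⟨h2, h3⟩, trivial⟩
  have hDinj : ∀ m₁ m₂, D (q, m₁) = true → D (q, m₂) = true →
      decodeD (List Bool) m₁.unpair.1 = decodeD (List Bool) m₂.unpair.1 →
      m₁ = m₂ := by
    have key : ∀ m₁ m₂, D (q, m₁) = true → D (q, m₂) = true →
        decodeD (List Bool) m₁.unpair.1 = decodeD (List Bool) m₂.unpair.1 →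
        m₂.unpair.2 ≤ m₁.unpair.2 := by
      intro m₁ m₂ h1 h2 h12
      by_contra hlt
      simp only [D, Bool.and_eq_true, Bool.or_eq_true, decide_eq_true_eq,
        Bool.not_eq_true'] at h1 h2
      rcases h2.1.2 with h3 | h3
      · omega
      · rw [← h12, hTm _ _ _ (by omega) h1.1.1] at h3
        exact absurd h3 (by simp)
    intro m₁ m₂ h1 h2 h12
    have e1 : m₁.unpair.2 = m₂.unpair.2 := le_antisymm (key _ _ h2 h1 h12.symm) (key _ _ h1 h2 h12)
    have e2 : m₁.unpair.1 = m₂.unpair.1 := by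
      simp only [D, Bool.and_eq_true, decide_eq_true_eq] at h1 h2
      rw [← h1.2, ← h2.2, h12]
    rw [← Nat.pair_unpair m₁, ← Nat.pair_unpair m₂, e1, e2]
  set r := Nat.count (fun k => D (q, k) = true) m with hr
  have hrF : r + 1 ≤ F.card := by
    have h1 : r + 1 = ((Finset.range (m + 1)).filter fun k => D (q, k) = true).card := by
      rw [← Nat.count_eq_card_filter_range, Nat.count_succ, if_pos hm]
    rw [h1]
    refine Finset.card_le_card_of_injOn
      (fun k => decodeD (List Bool) k.unpair.1) ?_ ?_
    · intro k hk
      have hk' := (Finset.mem_filter.1 hk).2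
      refine hF _ ((hTS _).2 ⟨k.unpair.2, ?_⟩)
      simp only [D, Bool.and_eq_true] at hk'
      exact hk'.1.1
    · intro k₁ h1 k₂ h2 h12
      exact hDinj _ _ (Finset.mem_filter.1 h1).2 (Finset.mem_filter.1 h2).2 h12
  have hgh : g ≤ h := by
    have h1 : 2 ^ g ≤ 2 ^ h := le_trans (Nat.le_mul_of_pos_left _ (by omega)) hcard
    exact (Nat.pow_le_pow_iff_right (by norm_num)).1 h1
  have hr2 : r < 2 ^ (h - g) := by
    have h1 : 2 ^ h = 2 ^ (h - g) * 2 ^ g := by rw [← pow_add]; congr 1; omega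
    rw [h1] at hcard
    have := Nat.le_of_mul_le_mul_right hcard (by positivity)
    omega
  -- the program for `w`
  let p : List Bool := List.replicate (Nat.size q) true ++
    false :: (initSeg q.testBit (Nat.size q) ++ initSeg r.testBit (h - g))
  have hpi : idx p = Nat.size q := by
    have h0 : (List.replicate (Nat.size q) true).findIdx (fun b => !b) = Nat.size q := by
      simpa using List.findIdx_eq_length_of_false
        (xs := List.replicate (Nat.size q) true) (p := fun b => !b) (by simp)
    simp [idx, p, List.findIdx_append, List.findIdx_cons, h0]
  have hpd : p.drop (Nat.size q + 1) =
      initSeg q.testBit (Nat.size q) ++ initSeg r.testBit (h - g) := by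
    simp [p, List.drop_append]
  have hpQ : Q p = q := by
    simp only [Q, hpi, hpd]
    rw [List.take_left' (by simp), listCode_initSeg, prefixCode_testBit,
      Nat.mod_eq_of_lt (Nat.lt_size_self q)]
  have hpt : t p = r := by
    simp only [t, hpi, hpd]
    rw [List.drop_left' (by simp), listCode_initSeg, prefixCode_testBit, Nat.mod_eq_of_lt hr2]
  have hMp : w ∈ M p := by
    refine (Part.mem_map_iff _).2 ⟨m, Nat.mem_rfind.2 ⟨?_, fun {k} hk => ?_⟩, hmw⟩
    · simp [B, hpQ, hpt, hm, ← hr]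
    · by_contra hne
      have h1 : B (p, k) = true := by simpa using hne
      simp only [B, hpQ, hpt, Bool.and_eq_true, decide_eq_true_eq] at h1
      have := Nat.count_injective h1.1 hm (h1.2.trans hr)
      omega
  have h1 := (hc w).trans (add_le_add_left (complexity_le_of_mem hMp) _)
  have h2 : p.length = 2 * Nat.size q + 1 + (h - g) := by
    simp [p]; omega
  rw [h2] at h1
  calc complexity U w + g ≤ ((2 * Nat.size q + 1 + (h - g) : ℕ) : ℕ∞) + c + g := by
        gcongr
    _ = ((2 * Nat.size q + 1 + (h - g) + c + g : ℕ) : ℕ∞) := by push_cast; rfl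
    _ ≤ _ := by exact_mod_cast (by omega)

/-! ### Constructive dimension -/

theorem tsum_list_length (a : ℕ → ℝ≥0∞) :
    ∑' p : List Bool, a p.length = ∑' n : ℕ, 2 ^ n * a n := by
  rw [← (Equiv.sigmaFiberEquiv (List.length : List Bool → ℕ)).tsum_eq, ENNReal.tsum_sigma']
  refine tsum_congr fun n => ?_
  have h : ∀ p : {l : List Bool // l.length = n},
      a (Equiv.sigmaFiberEquiv (List.length : List Bool → ℕ) ⟨n, p⟩).length = a n := by
    rintro ⟨p, rfl⟩; rfl
  simp only [h]
  have h2 : ∑' _ : List.Vector Bool n, a n = 2 ^ n * a n := by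
    rw [tsum_fintype, Finset.sum_const, nsmul_eq_mul, Finset.card_univ, card_vector]
    simp
  exact h2

/-- All strings of length `c * k` form a cover of weight `2 ^ (c * k * (1 - s))`, which is at most
`2 ^ (-k)` once `c * (s - 1) ≥ 1`. -/
theorem effectivelyNull_of_one_lt {s : ℝ} (hs : 1 < s) (x : BinSeq) : EffectivelyNull s x := by
  obtain ⟨c, hc⟩ := exists_nat_ge (1 / (s - 1))
  have hs' : 0 < s - 1 := by linarith
  rw [div_le_iff₀ hs'] at hc
  refine ⟨fun k => {w | w.length = c * k}, ?_, fun k => ⟨⟨c * k, by simp⟩, ?_⟩⟩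
  · refine (rePred_of_isComputable
      (T := fun a : ℕ × List Bool => decide (a.2.length = c * a.1)) (by fun_prop)).of_eq ?_
    simp
  · rw [tsum_subtype {w : List Bool | w.length = c * k}
      (fun w => (2 : ℝ≥0∞) ^ (-s * (w.length : ℝ)))]
    have h1 : ∀ w : List Bool, Set.indicator {w : List Bool | w.length = c * k}
        (fun w => (2 : ℝ≥0∞) ^ (-s * (w.length : ℝ))) w =
        (fun n : ℕ => if n = c * k then (2 : ℝ≥0∞) ^ (-s * (n : ℝ)) else 0) w.length := by
      intro w
      simp [Set.indicator_apply]
    simp only [h1]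
    rw [tsum_list_length (fun n : ℕ => if n = c * k then (2 : ℝ≥0∞) ^ (-s * (n : ℝ)) else 0),
      tsum_eq_single (c * k) (fun n hn => by simp [hn]), if_pos rfl, ← ENNReal.rpow_natCast,
      ← ENNReal.rpow_add _ _ (by norm_num) (by norm_num)]
    refine ENNReal.rpow_le_rpow_of_exponent_le (by norm_num) ?_
    push_cast
    have : (0 : ℝ) ≤ k := k.cast_nonneg
    nlinarith

theorem constructiveDim_le_one (x : BinSeq) : constructiveDim x ≤ 1 := by
  refine le_of_forall_gt_imp_ge_of_dense fun s hs => csInf_le ⟨0, fun _ h => h.1⟩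
    ⟨by linarith, effectivelyNull_of_one_lt hs x⟩

theorem one_le_constructiveDim {x : BinSeq}
    (h : ∀ s : ℝ, s < 1 → ¬ EffectivelyNull s x) : 1 ≤ constructiveDim x := by
  -- The set must be seen to be nonempty, since the real infimum of the empty set is `0`.
  refine le_csInf ⟨2, by norm_num, effectivelyNull_of_one_lt (by norm_num) x⟩ fun s hs => ?_
  by_contra h1
  exact h s (not_le.1 h1) hs.2

/-- Programs for plain complexity need not form a prefix-free set, so there is no Kraft inequality.
The weight `2 ^ (-2 * |p|)` is summable over all strings, and a constant factor in the exponent does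
no harm. -/
theorem tsum_two_rpow_neg_two_mul_length :
    ∑' p : List Bool, (2 : ℝ≥0∞) ^ (-2 * (p.length : ℝ)) = 2 := by
  rw [tsum_list_length fun n => (2 : ℝ≥0∞) ^ (-2 * (n : ℝ))]
  refine Eq.trans ?_ ENNReal.tsum_geometric_two
  refine tsum_congr fun n => ?_
  rw [← ENNReal.rpow_natCast, ← ENNReal.rpow_add _ _ (by norm_num) (by norm_num),
    ← ENNReal.rpow_natCast, ENNReal.inv_rpow, ← ENNReal.rpow_neg]
  ring_nf

/-- A sequence of positive constructive dimension has initial segments of linear complexity. -/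
theorem exists_le_mul_complexity {U : List Bool →. List Bool} (hU : IsUniversal U) {x : BinSeq}
    {τ : ℝ} (hτ : 0 < τ) (hx : τ ≤ constructiveDim x) :
    ∃ c N : ℕ, ∀ n, N ≤ n → ∀ k : ℕ, complexity U (initSeg x n) ≤ k → n ≤ c * k := by
  -- Of the exponent `3 * |w| / c`, one third yields the factor `2 ^ (-(k + 1))`, as `|w| ≥ c * (k +
  -- 1)`, and two thirds dominate `2 * |p|` for a program `p` of `w`, as `|w| > c * |p|`.
  obtain ⟨c, hc⟩ := exists_nat_gt (3 / τ)
  have hc0 : (0 : ℝ) < c := (by positivity : 0 < 3 / τ).trans hc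
  have hcτ : 3 / (c : ℝ) < τ := by
    rw [div_lt_iff₀ hτ] at hc
    rw [div_lt_iff₀ hc0]; linarith
  by_contra hcon
  push Not at hcon
  have hnull : EffectivelyNull (3 / c) x := by
    let V : ℕ → Set (List Bool) := fun k =>
      {w | c * (k + 1) ≤ w.length ∧ ∃ l : ℕ, complexity U w ≤ l ∧ c * l < w.length}
    refine ⟨V, ?_, fun k => ⟨?_, ?_⟩⟩
    · have h1 : REPred fun a : (ℕ × List Bool) × ℕ =>
          complexity U a.1.2 ≤ a.2 ∧
            (decide (c * (a.1.1 + 1) ≤ a.1.2.length) && decide (c * a.2 < a.1.2.length)) = true :=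
        rePred_and (P := fun a : (ℕ × List Bool) × ℕ => complexity U a.1.2 ≤ a.2)
          (rePred_comp (rePred_complexity_le hU.1)
            (f := fun a : (ℕ × List Bool) × ℕ => (a.2, a.1.2)) (by fun_prop))
          (rePred_of_isComputable (T := fun a : (ℕ × List Bool) × ℕ =>
            (decide (c * (a.1.1 + 1) ≤ a.1.2.length) && decide (c * a.2 < a.1.2.length)))
            (by fun_prop))
      refine (rePred_exists (P := fun a : (ℕ × List Bool) × ℕ =>
          complexity U a.1.2 ≤ a.2 ∧
            (decide (c * (a.1.1 + 1) ≤ a.1.2.length) && decide (c * a.2 < a.1.2.length)) = true)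
          h1).of_eq fun a => ?_
      simp only [V, Set.mem_ofPred_eq, Bool.and_eq_true, decide_eq_true_eq]
      constructor
      · rintro ⟨l, h2, h3, h4⟩; exact ⟨h3, l, h2, h4⟩
      · rintro ⟨h3, l, h2, h4⟩; exact ⟨l, h2, h3, h4⟩
    · obtain ⟨n, hn, l, hl, hnl⟩ := hcon c (c * (k + 1))
      exact ⟨n, by simpa using hn, l, hl, by simpa using hnl⟩
    · have h1 : ∀ w : V k, ∃ p : List Bool, (w : List Bool) ∈ U p ∧
          c * p.length < (w : List Bool).length := by
        rintro ⟨w, -, l, h2, h3⟩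
        obtain ⟨p, hp, hw⟩ := complexity_le_iff.1 h2
        exact ⟨p, hw, (Nat.mul_le_mul_left c hp).trans_lt h3⟩
      choose p hpU hpc using h1
      have hinj : Function.Injective p := fun w₁ w₂ h => by
        have h2 := hpU w₂
        rw [← h] at h2
        exact Subtype.ext (Part.mem_unique (hpU w₁) h2)
      calc ∑' w : V k, (2 : ℝ≥0∞) ^ (-(3 / (c : ℝ)) * ((w : List Bool).length : ℝ))
          ≤ ∑' w : V k, (2 : ℝ≥0∞) ^ (-((k : ℝ) + 1)) *
              (2 : ℝ≥0∞) ^ (-2 * ((p w).length : ℝ)) := by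
            refine ENNReal.tsum_le_tsum fun w => ?_
            rw [← ENNReal.rpow_add _ _ (by norm_num) (by norm_num)]
            refine ENNReal.rpow_le_rpow_of_exponent_le (by norm_num) ?_
            have h2 : (c : ℝ) * ((p w).length : ℝ) ≤ ((w : List Bool).length : ℝ) := by
              exact_mod_cast (hpc w).le
            have h3 : (c : ℝ) * ((k : ℝ) + 1) ≤ ((w : List Bool).length : ℝ) := by
              exact_mod_cast w.2.1
            have h4 : (k : ℝ) + 1 + 2 * ((p w).length : ℝ) ≤
                3 / (c : ℝ) * ((w : List Bool).length : ℝ) := by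
              rw [div_mul_eq_mul_div, le_div_iff₀ hc0]; linarith
            linarith
        _ = (2 : ℝ≥0∞) ^ (-((k : ℝ) + 1)) *
              ∑' w : V k, (2 : ℝ≥0∞) ^ (-2 * ((p w).length : ℝ)) := ENNReal.tsum_mul_left
        _ ≤ (2 : ℝ≥0∞) ^ (-((k : ℝ) + 1)) * 2 := by
            gcongr
            exact (ENNReal.tsum_comp_le_tsum_of_injective hinj
              fun p : List Bool => (2 : ℝ≥0∞) ^ (-2 * (p.length : ℝ))).trans
                tsum_two_rpow_neg_two_mul_length.le
        _ = (2 : ℝ≥0∞) ^ (-(k : ℝ)) := by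
            conv_lhs => rw [← ENNReal.rpow_one 2, ← ENNReal.rpow_mul,
              ← ENNReal.rpow_add _ _ (by norm_num) (by norm_num)]
            congr 1; ring
  exact absurd (csInf_le ⟨0, fun _ h => h.1⟩
    (show (3 / (c : ℝ)) ∈ {s : ℝ | 0 ≤ s ∧ EffectivelyNull s x} from ⟨by positivity, hnull⟩))
    (not_le.2 (hcτ.trans_le hx))

/-- If `{z}` is effectively `s`-null for some `s < 1`, then `z` has initial segments in sparse
recursively enumerable sets. -/
theorem EffectivelyNull.exists_sparse {s : ℝ} (hs : s < 1) {z : BinSeq}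
    (hz : EffectivelyNull s z) :
    ∃ (c : ℕ) (V : ℕ × List Bool → Prop), 0 < c ∧ REPred V ∧ ∀ k, ∃ n, k ≤ n ∧ V (k, initSeg z n) ∧
      ∀ F : Finset (List Bool), (∀ w ∈ F, w.length = n ∧ V (k, w)) →
        F.card * 2 ^ (n / c) ≤ 2 ^ n := by
  obtain ⟨V, hV, hVz⟩ := hz
  -- With this `c`, `n / c ≤ (1 - s) * n`, and the sum bound permits at most `2 ^ (s * n)` strings
  -- of length `n`.
  obtain ⟨c, hc⟩ := exists_nat_gt (1 / (1 - s))
  have hs' : 0 < 1 - s := by linarith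
  have hc0 : (0 : ℝ) < c := (by positivity : 0 < 1 / (1 - s)).trans hc
  rw [div_lt_iff₀ hs'] at hc
  refine ⟨c, fun a => a.2 ∈ V a.1, by exact_mod_cast hc0, hV, fun k => ?_⟩
  obtain ⟨⟨n, hn⟩, hsum⟩ := hVz k
  refine ⟨n, ?_, hn, fun F hF => ?_⟩
  · have h1 := (ENNReal.le_tsum (⟨_, hn⟩ : V k)).trans hsum
    simp only [length_initSeg] at h1
    have h1 : -s * (n : ℝ) ≤ -(k : ℝ) := by
      by_contra h
      exact absurd h1 (not_le.2 (ENNReal.rpow_lt_rpow_of_exponent_lt (by norm_num) (by norm_num)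
        (not_le.1 h)))
    have h2 : (0 : ℝ) ≤ n := n.cast_nonneg
    have : (k : ℝ) ≤ n := by nlinarith
    exact_mod_cast this
  · have h1 : (F.card : ℝ≥0∞) * 2 ^ (-s * (n : ℝ)) ≤ 1 := by
      let G : Finset (V k) := F.attach.map
        ⟨fun w => ⟨w.1, (hF w.1 w.2).2⟩, fun a b h => Subtype.ext (congrArg (fun t => t.1) h)⟩
      have h2 := (ENNReal.sum_le_tsum (f := fun w : V k =>
        (2 : ℝ≥0∞) ^ (-s * ((w : List Bool).length : ℝ))) G).trans hsum
      rw [Finset.sum_map] at h2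
      change ∑ w ∈ F.attach, (2 : ℝ≥0∞) ^ (-s * ((w : List Bool).length : ℝ)) ≤ _ at h2
      rw [Finset.sum_attach F (fun w => (2 : ℝ≥0∞) ^ (-s * (w.length : ℝ))),
        Finset.sum_congr rfl (fun w hw => by rw [(hF w hw).1]), Finset.sum_const,
        nsmul_eq_mul] at h2
      refine h2.trans ?_
      calc (2 : ℝ≥0∞) ^ (-(k : ℝ)) ≤ 2 ^ (0 : ℝ) :=
            ENNReal.rpow_le_rpow_of_exponent_le (by norm_num) (by simp)
        _ = 1 := by simp
    have h2 : (F.card : ℝ≥0∞) ≤ 2 ^ (s * (n : ℝ)) := by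
      calc (F.card : ℝ≥0∞) = F.card * 2 ^ (-s * (n : ℝ)) * 2 ^ (s * (n : ℝ)) := by
            rw [mul_assoc, ← ENNReal.rpow_add _ _ (by norm_num) (by norm_num)]
            simp
        _ ≤ 1 * 2 ^ (s * (n : ℝ)) := by gcongr
        _ = _ := one_mul _
    have h3 : ((F.card * 2 ^ (n / c) : ℕ) : ℝ≥0∞) ≤ ((2 ^ n : ℕ) : ℝ≥0∞) := by
      push_cast
      calc (F.card : ℝ≥0∞) * 2 ^ (n / c)
          ≤ 2 ^ (s * (n : ℝ)) * (2 : ℝ≥0∞) ^ (((n / c : ℕ) : ℝ)) := by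
            rw [ENNReal.rpow_natCast]; gcongr
        _ = 2 ^ (s * (n : ℝ) + ((n / c : ℕ) : ℝ)) := by
            rw [ENNReal.rpow_add _ _ (by norm_num) (by norm_num)]
        _ ≤ 2 ^ (n : ℝ) := by
            refine ENNReal.rpow_le_rpow_of_exponent_le (by norm_num) ?_
            have h4 : ((n / c : ℕ) : ℝ) ≤ (n : ℝ) / c := Nat.cast_div_le
            have h5 : (n : ℝ) / c ≤ (1 - s) * n := by
              rw [div_le_iff₀ hc0]
              have h6 : (0 : ℝ) ≤ n := n.cast_nonneg
              nlinarith
            linarith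
        _ = 2 ^ n := ENNReal.rpow_natCast _ _
    exact_mod_cast h3

/-! ### Oracle programs -/

/-- A program without oracle queries, as an oracle program. -/
def OracleCode.ofCode : Nat.Partrec.Code → OracleCode
  | .zero => .zero
  | .succ => .succ
  | .left => .left
  | .right => .right
  | .pair f g => .pair (ofCode f) (ofCode g)
  | .comp f g => .comp (ofCode f) (ofCode g)
  | .prec f g => .prec (ofCode f) (ofCode g)
  | .rfind' f => .rfind' (ofCode f)

theorem OracleCode.eval_ofCode (x y : BinSeq) (c : Nat.Partrec.Code) :
    (ofCode c).eval x y = c.eval := by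
  induction c with
  | zero => rfl
  | succ => rfl
  | left => rfl
  | right => rfl
  | pair f g hf hg => simp only [ofCode, eval, Nat.Partrec.Code.eval, hf, hg]; rfl
  | comp f g hf hg => simp only [ofCode, eval, Nat.Partrec.Code.eval, hf, hg]; rfl
  | prec f g hf hg => simp only [ofCode, eval, Nat.Partrec.Code.eval, hf, hg]; rfl
  | rfind' f hf => simp only [ofCode, eval, Nat.Partrec.Code.eval, hf]; rfl

theorem OracleCode.exists_eval_eq_some {f : ℕ → ℕ} (hf : IsComputable f) :
    ∃ M : OracleCode, ∀ x y n, M.eval x y n = Part.some (f n) := by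
  obtain ⟨c, hc⟩ := Nat.Partrec.Code.exists_code.1 (Partrec.nat_iff.1 hf.out.partrec)
  exact ⟨.ofCode c, fun x y n => by rw [eval_ofCode, hc]; rfl⟩

theorem OracleCode.eval_comp_some {x y : BinSeq} {F G : OracleCode} {n a b : ℕ}
    (hG : G.eval x y n = Part.some a) (hF : F.eval x y a = Part.some b) :
    (comp F G).eval x y n = Part.some b := by
  simp only [eval, hG]
  exact (Part.bind_some _ _).trans hF

theorem OracleCode.eval_pair_some {x y : BinSeq} {F G : OracleCode} {n a b : ℕ}
    (hF : F.eval x y n = Part.some a) (hG : G.eval x y n = Part.some b) :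
    (pair F G).eval x y n = Part.some (Nat.pair a b) := by
  simp [eval, hF, hG, Seq.seq]

/-- With a query instruction, a program can compute codes of initial segments of the oracle. -/
theorem OracleCode.exists_eval_prefixCode (Q : OracleCode) (o : BinSeq → BinSeq → BinSeq)
    (hQ : ∀ x y n, Q.eval x y n = Part.some (o x y n).toNat) :
    ∃ M : OracleCode, ∀ x y n, M.eval x y n = Part.some (prefixCode (o x y) n) := by
  obtain ⟨A, hA⟩ := exists_eval_eq_some (f := fun n => n.unpair.2.unpair.1) (by fun_prop)
  obtain ⟨B, hB⟩ := exists_eval_eq_some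
    (f := fun n => n.unpair.1.unpair.2.unpair.2 + n.unpair.2 * 2 ^ n.unpair.1.unpair.2.unpair.1)
    (by fun_prop)
  obtain ⟨I, hI⟩ := exists_eval_eq_some (f := fun n => n) (by fun_prop)
  obtain ⟨P, hP⟩ := exists_eval_eq_some (f := fun n => Nat.pair 0 n) (by fun_prop)
  -- Primitive recursion adds one digit per step: `A` extracts the counter, `Q` queries the oracle
  -- there, and `B` adds the bit, times its power of two, to the accumulator.
  let R : OracleCode := prec zero (comp B (pair I (comp Q A)))
  have hR : ∀ x y n, R.eval x y (Nat.pair 0 n) = Part.some (prefixCode (o x y) n) := by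
    intro x y n
    simp only [R, eval, Nat.unpaired, Nat.unpair_pair]
    induction n with
    | zero => rfl
    | succ n ih =>
      have h1 : (comp B (pair I (comp Q A))).eval x y
          (Nat.pair 0 (Nat.pair n (prefixCode (o x y) n))) =
          Part.some (prefixCode (o x y) (n + 1)) := by
        refine eval_comp_some (eval_pair_some (hI _ _ _)
          (eval_comp_some (hA _ _ _) (hQ _ _ _))) ?_
        rw [hB, prefixCode_succ]
        simp
      rw [← h1]
      simp only [ih]
      exact Part.bind_some _ _
  exact ⟨comp R P, fun x y n => eval_comp_some (hP _ _ _) (hR _ _ _)⟩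

/-- A map whose `n`-th value depends computably on initial segments of computable length is computed
by an oracle program. -/
theorem OracleCode.exists_eval_eq_apply_prefixCode {N : ℕ → ℕ} (hN : IsComputable N)
    {g : ℕ × ℕ × ℕ → Bool} (hg : IsComputable g) :
    ∃ M : OracleCode, ∀ x y n, M.eval x y n =
      Part.some (g (n, prefixCode x (N n), prefixCode y (N n))).toNat := by
  obtain ⟨X, hX⟩ := exists_eval_prefixCode query₁ (fun x _ => x) fun _ _ _ => rfl
  obtain ⟨Y, hY⟩ := exists_eval_prefixCode query₂ (fun _ y => y) fun _ _ _ => rfl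
  obtain ⟨I, hI⟩ := exists_eval_eq_some (f := fun n => n) (by fun_prop)
  obtain ⟨C, hC⟩ := exists_eval_eq_some hN
  obtain ⟨G, hG⟩ := exists_eval_eq_some
    (f := fun n => (g (n.unpair.1, n.unpair.2.unpair.1, n.unpair.2.unpair.2)).toNat) (by fun_prop)
  refine ⟨comp G (pair I (pair (comp X C) (comp Y C))), fun x y n => ?_⟩
  refine eval_comp_some (eval_pair_some (hI _ _ _) (eval_pair_some
    (eval_comp_some (hC _ _ _) (hX _ _ _)) (eval_comp_some (hC _ _ _) (hY _ _ _)))) ?_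
  rw [hG]
  simp

theorem isTruthTableReduction_of_eval_eq {f : BinSeq → BinSeq → BinSeq} {M : OracleCode}
    (hM : ∀ x y n, M.eval x y n = Part.some (f x y n).toNat) : IsTruthTableReduction f :=
  ⟨M, fun x y n => by rw [hM]; trivial, fun x y n => by rw [hM]; exact Part.mem_some _⟩

theorem isUniformTruthTableReduction_of_eval_eq {f : BinSeq → BinSeq → BinSeq} {M : OracleCode}
    (hM : ∀ x y n, M.eval x y n = Part.some (f x y n).toNat) :
    IsUniformTruthTableReduction fun _ => f := by
  -- The code of a triple is a nested pair, so this discards the numerator and the denominator.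
  obtain ⟨P, hP⟩ := OracleCode.exists_eval_eq_some (f := fun n => n.unpair.2.unpair.2)
    (by fun_prop)
  have h : ∀ x y n, (OracleCode.comp M P).eval x y n =
      Part.some (f x y n.unpair.2.unpair.2).toNat :=
    fun x y n => OracleCode.eval_comp_some (hP _ _ _) (hM _ _ _)
  refine ⟨.comp M P, fun x y n => by rw [h]; trivial, fun τ x y n => ?_⟩
  rw [h]
  simp

/-! ### Balanced functions on rectangles -/

/-- The exponential moment of the number of hits factors over the independent coordinates: each one
in `W` contributes `D + 1` and each other one `D`, with `D` the size of `β`. -/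
theorem sum_two_pow_card_filter {ι β : Type*} [Fintype ι] [DecidableEq ι] [Fintype β]
    [DecidableEq β] (W : Finset ι) (b : β) (hβ : 0 < Fintype.card β) :
    ∑ e : ι → β, (2 : ℝ) ^ (W.filter fun i => e i = b).card =
      (Fintype.card β : ℝ) ^ Fintype.card ι * (1 + 1 / (Fintype.card β : ℝ)) ^ W.card := by
  have hβ' : (Fintype.card β : ℝ) ≠ 0 := by positivity
  have h1 : ∀ e : ι → β, (2 : ℝ) ^ (W.filter fun i => e i = b).card =
      ∏ i, (1 + if i ∈ W ∧ e i = b then (1 : ℝ) else 0) := by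
    intro e
    rw [Finset.prod_congr rfl (g := fun i => if i ∈ W ∧ e i = b then (2 : ℝ) else 1)
      (fun i _ => by split_ifs <;> norm_num), ← Finset.prod_filter, Finset.prod_const]
    congr 2
    ext i
    simp
  have h2 : ∀ i, ∑ c : β, (1 + if i ∈ W ∧ c = b then (1 : ℝ) else 0) =
      (Fintype.card β : ℝ) * if i ∈ W then 1 + 1 / (Fintype.card β : ℝ) else 1 := by
    intro i
    rw [Finset.sum_add_distrib]
    by_cases hi : i ∈ W
    · simp [hi]; field_simp
    · simp [hi]
  rw [Finset.sum_congr rfl fun e _ => h1 e, ← Fintype.piFinset_univ,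
    ← Finset.prod_univ_sum (fun _ => Finset.univ)
      (fun i c => 1 + if i ∈ W ∧ c = b then (1 : ℝ) else 0),
    Finset.prod_congr rfl fun i _ => h2 i, Finset.prod_mul_distrib]
  simp [Finset.prod_ite_mem, Finset.card_univ]

theorem one_add_inv_pow_le {D : ℕ} (hD : 0 < D) (w : ℕ) :
    (1 + 1 / (D : ℝ)) ^ w ≤ 2 ^ (2 * (w / D + 1)) := by
  have hD' : (0 : ℝ) < D := by exact_mod_cast hD
  have h1 : (1 + 1 / (D : ℝ)) ^ D ≤ 4 := by
    have h2 : 1 + 1 / (D : ℝ) ≤ Real.exp (1 / D) := by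
      linarith [Real.add_one_le_exp (1 / (D : ℝ))]
    calc (1 + 1 / (D : ℝ)) ^ D ≤ Real.exp (1 / D) ^ D := by gcongr
      _ = Real.exp 1 := by rw [← Real.exp_nat_mul]; congr 1; field_simp
      _ ≤ 4 := by linarith [Real.exp_one_lt_d9]
  have h3 : w ≤ D * (w / D + 1) := (Nat.lt_mul_div_succ w hD).le
  calc (1 + 1 / (D : ℝ)) ^ w ≤ (1 + 1 / (D : ℝ)) ^ (D * (w / D + 1)) :=
        pow_le_pow_right₀ (by linarith [(by positivity : 0 < 1 / (D : ℝ))]) h3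
    _ = ((1 + 1 / (D : ℝ)) ^ D) ^ (w / D + 1) := pow_mul _ _ _
    _ ≤ 4 ^ (w / D + 1) := by gcongr
    _ = 2 ^ (2 * (w / D + 1)) := by rw [pow_mul]; norm_num

/-- By the binomial theorem the sum is `(1 + 2 ^ (-κ)) ^ |α|`, which is at most `e`. This makes the
union bound over subsets of all sizes converge. -/
theorem sum_pow_card_lt {α : Type*} [Fintype α] {κ : ℕ} (h : Fintype.card α ≤ 2 ^ κ) :
    ∑ X : Finset α, ((1 / 2 : ℝ) ^ κ) ^ X.card < 3 := by
  have h1 := Fintype.sum_pow_mul_eq_add_pow α ((1 / 2 : ℝ) ^ κ) 1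
  simp only [one_pow, mul_one] at h1
  rw [h1]
  calc ((1 / 2 : ℝ) ^ κ + 1) ^ Fintype.card α
      ≤ Real.exp ((1 / 2 : ℝ) ^ κ) ^ Fintype.card α := by
        gcongr; exact Real.add_one_le_exp _
    _ = Real.exp (Fintype.card α * (1 / 2 : ℝ) ^ κ) := by rw [← Real.exp_nat_mul]
    _ ≤ Real.exp 1 := by
        refine Real.exp_le_exp.2 ?_
        have h2 : (Fintype.card α : ℝ) ≤ 2 ^ κ := by exact_mod_cast h
        calc (Fintype.card α : ℝ) * (1 / 2 : ℝ) ^ κ ≤ 2 ^ κ * (1 / 2 : ℝ) ^ κ := by gcongr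
          _ = 1 := by rw [← mul_pow]; norm_num
    _ < 3 := by linarith [Real.exp_one_lt_d9]

/-- By a union bound, some function is nearly balanced on all combinatorial rectangles. -/
theorem exists_balanced_fintype {α β : Type*} [Fintype α] [DecidableEq α] [Fintype β]
    [DecidableEq β] (hβ : 0 < Fintype.card β) {κ : ℕ} (hα : Fintype.card α ≤ 2 ^ κ)
    (hκ : 9 * Fintype.card β ≤ 2 ^ κ) :
    ∃ e : α × α → β, ∀ (X Y : Finset α) (b : β), ((X ×ˢ Y).filter fun p => e p = b).card <
      2 * (X.card * Y.card / Fintype.card β + 1) + κ * (X.card + Y.card + 1) := by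
  by_contra hcon
  push Not at hcon
  set D := Fintype.card β with hD
  -- In the threshold `t`, the first summand pays for the exponential moment of the number of hits,
  -- and the second pays for the union over `X`, `Y` and `b`.
  let t : Finset α → Finset α → ℕ := fun X Y =>
    2 * (X.card * Y.card / D + 1) + κ * (X.card + Y.card + 1)
  have h1 : ∀ e : α × α → β, (1 : ℝ) ≤ ∑ X : Finset α, ∑ Y : Finset α, ∑ b : β,
      (1 / 2 : ℝ) ^ t X Y * 2 ^ ((X ×ˢ Y).filter fun p => e p = b).card := by
    intro e
    obtain ⟨X, Y, b, hXY⟩ := hcon e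
    have h2 : (1 : ℝ) ≤ (1 / 2 : ℝ) ^ t X Y * 2 ^ ((X ×ˢ Y).filter fun p => e p = b).card := by
      calc (1 : ℝ) = (1 / 2 : ℝ) ^ t X Y * 2 ^ t X Y := by rw [← mul_pow]; norm_num
        _ ≤ _ := by gcongr; norm_num
    refine h2.trans ?_
    refine le_trans ?_ (Finset.single_le_sum (fun X _ => Finset.sum_nonneg fun Y _ =>
      Finset.sum_nonneg fun b _ => by positivity) (Finset.mem_univ X))
    refine le_trans ?_ (Finset.single_le_sum (fun Y _ => Finset.sum_nonneg fun b _ =>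
      by positivity) (Finset.mem_univ Y))
    exact Finset.single_le_sum (f := fun b => (1 / 2 : ℝ) ^ t X Y *
      2 ^ ((X ×ˢ Y).filter fun p => e p = b).card) (fun b _ => by positivity) (Finset.mem_univ b)
  have h2 : ((D : ℝ) ^ Fintype.card (α × α)) ≤ ∑ e : α × α → β, ∑ X : Finset α, ∑ Y : Finset α,
      ∑ b : β, (1 / 2 : ℝ) ^ t X Y * 2 ^ ((X ×ˢ Y).filter fun p => e p = b).card := by
    calc ((D : ℝ) ^ Fintype.card (α × α)) = ∑ e : α × α → β, (1 : ℝ) := by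
          simp [hD]
      _ ≤ _ := Finset.sum_le_sum fun e _ => h1 e
  have h3 : ∑ e : α × α → β, ∑ X : Finset α, ∑ Y : Finset α,
      ∑ b : β, (1 / 2 : ℝ) ^ t X Y * 2 ^ ((X ×ˢ Y).filter fun p => e p = b).card
      = ∑ X : Finset α, ∑ Y : Finset α, ∑ b : β, (1 / 2 : ℝ) ^ t X Y *
        ((D : ℝ) ^ Fintype.card (α × α) * (1 + 1 / (D : ℝ)) ^ (X.card * Y.card)) := by
    rw [Finset.sum_comm]
    refine Finset.sum_congr rfl fun X _ => ?_
    rw [Finset.sum_comm]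
    refine Finset.sum_congr rfl fun Y _ => ?_
    rw [Finset.sum_comm]
    refine Finset.sum_congr rfl fun b _ => ?_
    rw [← Finset.mul_sum, sum_two_pow_card_filter _ _ hβ, Finset.card_product]
  have hDpos : (0 : ℝ) < D := by exact_mod_cast hβ
  have h4 : ∀ X Y : Finset α, (1 / 2 : ℝ) ^ t X Y *
        ((D : ℝ) ^ Fintype.card (α × α) * (1 + 1 / (D : ℝ)) ^ (X.card * Y.card)) ≤
      (D : ℝ) ^ Fintype.card (α × α) * (1 / 2 : ℝ) ^ κ *
        (((1 / 2 : ℝ) ^ κ) ^ X.card * ((1 / 2 : ℝ) ^ κ) ^ Y.card) := by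
    intro X Y
    have h5 : (1 / 2 : ℝ) ^ (2 * (X.card * Y.card / D + 1)) *
        (1 + 1 / (D : ℝ)) ^ (X.card * Y.card) ≤ 1 := by
      calc _ ≤ (1 / 2 : ℝ) ^ (2 * (X.card * Y.card / D + 1)) *
            2 ^ (2 * (X.card * Y.card / D + 1)) := by
            gcongr; exact one_add_inv_pow_le hβ _
        _ = 1 := by rw [← mul_pow]; norm_num
    calc _ = ((1 / 2 : ℝ) ^ (2 * (X.card * Y.card / D + 1)) *
            (1 + 1 / (D : ℝ)) ^ (X.card * Y.card)) * ((D : ℝ) ^ Fintype.card (α × α) *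
              (1 / 2 : ℝ) ^ κ * (((1 / 2 : ℝ) ^ κ) ^ X.card * ((1 / 2 : ℝ) ^ κ) ^ Y.card)) := by
          simp only [t, pow_add, mul_add, pow_mul]; ring
      _ ≤ 1 * _ := by gcongr
      _ = _ := one_mul _
  have h6 : ∑ X : Finset α, ∑ Y : Finset α, ∑ b : β, (1 / 2 : ℝ) ^ t X Y *
        ((D : ℝ) ^ Fintype.card (α × α) * (1 + 1 / (D : ℝ)) ^ (X.card * Y.card)) ≤
      (D : ℝ) ^ Fintype.card (α × α) * ((D : ℝ) * (1 / 2 : ℝ) ^ κ *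
        ((∑ X : Finset α, ((1 / 2 : ℝ) ^ κ) ^ X.card) *
          ∑ Y : Finset α, ((1 / 2 : ℝ) ^ κ) ^ Y.card)) := by
    calc _ ≤ ∑ X : Finset α, ∑ Y : Finset α, ∑ b : β,
          (D : ℝ) ^ Fintype.card (α × α) * (1 / 2 : ℝ) ^ κ *
            (((1 / 2 : ℝ) ^ κ) ^ X.card * ((1 / 2 : ℝ) ^ κ) ^ Y.card) :=
          Finset.sum_le_sum fun X _ => Finset.sum_le_sum fun Y _ =>
            Finset.sum_le_sum fun b _ => h4 X Y
      _ = _ := by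
          rw [Finset.sum_mul_sum]
          simp only [Finset.sum_const, Finset.card_univ, nsmul_eq_mul, Finset.mul_sum]
          refine Finset.sum_congr rfl fun X _ => Finset.sum_congr rfl fun Y _ => ?_
          rw [← hD]; ring
  -- Each of the two sums is below `3`, whence the `9` in the hypothesis on `κ`.
  have h7 : (D : ℝ) * (1 / 2 : ℝ) ^ κ * ((∑ X : Finset α, ((1 / 2 : ℝ) ^ κ) ^ X.card) *
      ∑ Y : Finset α, ((1 / 2 : ℝ) ^ κ) ^ Y.card) < 1 := by
    have h8 := sum_pow_card_lt hα
    have h9 : (0 : ℝ) ≤ ∑ X : Finset α, ((1 / 2 : ℝ) ^ κ) ^ X.card := by positivity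
    have h10 : 9 * (D : ℝ) ≤ 2 ^ κ := by exact_mod_cast hκ
    have h11 : (D : ℝ) * (1 / 2 : ℝ) ^ κ * 9 ≤ 1 := by
      calc (D : ℝ) * (1 / 2 : ℝ) ^ κ * 9 = 9 * (D : ℝ) * (1 / 2 : ℝ) ^ κ := by ring
        _ ≤ 2 ^ κ * (1 / 2 : ℝ) ^ κ := by gcongr
        _ = 1 := by rw [← mul_pow]; norm_num
    have h12 : (0 : ℝ) < (D : ℝ) * (1 / 2 : ℝ) ^ κ := by positivity
    refine lt_of_lt_of_le ?_ h11
    refine mul_lt_mul_of_pos_left ?_ h12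
    nlinarith
  have h13 : (0 : ℝ) < (D : ℝ) ^ Fintype.card (α × α) := by positivity
  rw [h3] at h2
  have h14 := h2.trans_lt (h6.trans_lt (mul_lt_mul_of_pos_left h7 h13))
  rw [mul_one] at h14
  exact lt_irrefl _ h14

/-- The function `e`, as a function from pairs of strings of length `n` to strings of length `m`, is
nearly balanced on all combinatorial rectangles. Strings are given by their binary codes. -/
def IsBalanced (n m : ℕ) (e : ℕ → ℕ → ℕ) : Prop :=
  ∀ X ⊆ Finset.range (2 ^ n), ∀ Y ⊆ Finset.range (2 ^ n), ∀ b < 2 ^ m,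
    ((X ×ˢ Y).filter fun p => e p.1 p.2 = b).card <
      2 * (X.card * Y.card / 2 ^ m + 1) + (n + m + 4) * (X.card + Y.card + 1)

theorem IsBalanced.congr {n m : ℕ} {e e' : ℕ → ℕ → ℕ} (h : IsBalanced n m e)
    (he : ∀ u < 2 ^ n, ∀ v < 2 ^ n, e' u v = e u v) : IsBalanced n m e' := by
  intro X hX Y hY b hb
  have h1 : ((X ×ˢ Y).filter fun p => e' p.1 p.2 = b) =
      (X ×ˢ Y).filter fun p => e p.1 p.2 = b := by
    refine Finset.filter_congr fun p hp => ?_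
    rw [Finset.mem_product] at hp
    rw [he _ (Finset.mem_range.1 (hX hp.1)) _ (Finset.mem_range.1 (hY hp.2))]
  rw [h1]
  exact h X hX Y hY b hb

theorem exists_isBalanced (n m : ℕ) :
    ∃ e : ℕ → ℕ → ℕ, (∀ u v, e u v < 2 ^ m) ∧ IsBalanced n m e := by
  obtain ⟨e, he⟩ := exists_balanced_fintype (α := Fin (2 ^ n)) (β := Fin (2 ^ m))
    (κ := n + m + 4) (by simp) (by simpa using Nat.pow_le_pow_right two_pos (by omega))
    (by
      have : 1 ≤ 2 ^ n := Nat.one_le_two_pow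
      rw [Fintype.card_fin, pow_add, pow_add]
      nlinarith [Nat.one_le_two_pow (n := m)])
  let r : ℕ → Fin (2 ^ n) := fun u => ⟨u % 2 ^ n, Nat.mod_lt _ (by positivity)⟩
  refine ⟨fun u v => e (r u, r v), fun u v => (e _).2, fun X hX Y hY b hb => ?_⟩
  have hr : ∀ X ⊆ Finset.range (2 ^ n), Set.InjOn r X := by
    intro X hX u hu v hv huv
    have h1 := Finset.mem_range.1 (hX hu)
    have h2 := Finset.mem_range.1 (hX hv)
    simpa [r, Nat.mod_eq_of_lt h1, Nat.mod_eq_of_lt h2] using huv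
  have h1 := he (X.image r) (Y.image r) ⟨b, hb⟩
  rw [Finset.card_image_of_injOn (hr X hX), Finset.card_image_of_injOn (hr Y hY),
    Fintype.card_fin] at h1
  refine lt_of_le_of_lt (Finset.card_le_card_of_injOn (fun p => (r p.1, r p.2)) ?_ ?_) h1
  · intro p hp
    simp only [Finset.coe_filter, Finset.mem_product, Set.mem_ofPred_eq] at hp
    simp only [Finset.coe_filter, Finset.mem_product, Set.mem_ofPred_eq]
    exact ⟨⟨Finset.mem_image_of_mem _ hp.1.1, Finset.mem_image_of_mem _ hp.1.2⟩,
      Fin.ext hp.2⟩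
  · intro p hp q hq hpq
    simp only [Finset.coe_filter, Finset.mem_product, Set.mem_ofPred_eq] at hp hq
    simp only [Prod.mk.injEq] at hpq
    exact Prod.ext (hr X hX hp.1.1 hq.1.1 hpq.1) (hr Y hY hp.1.2 hq.1.2 hpq.2)

/-- Bounded universal quantification over a decidable predicate. -/
def allBelow (p : ℕ → Bool) (n : ℕ) : Bool := decide (Nat.count (fun k => (!p k) = true) n = 0)

theorem allBelow_iff {p : ℕ → Bool} {n : ℕ} : allBelow p n = true ↔ ∀ k < n, p k = true := by
  unfold allBelow
  rw [decide_eq_true_eq, Nat.count_eq_card_filter_range, Finset.card_eq_zero,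
    Finset.filter_eq_empty_iff]
  simp

@[fun_prop]
theorem isComputable_allBelow {α : Type*} [Primcodable α] {f : α → ℕ}
    {p : α → ℕ → Bool} (hf : IsComputable f) (hp : IsComputable fun a : α × ℕ => p a.1 a.2) :
    IsComputable (fun a => allBelow (p a) (f a)) := by
  unfold allBelow
  fun_prop

theorem filter_range_testBit_prefixCode {N : ℕ} {X : Finset ℕ} (hX : X ⊆ Finset.range N) :
    (Finset.range N).filter (fun u => (prefixCode (fun u => decide (u ∈ X)) N).testBit u = true)
      = X := by
  ext u
  simp only [testBit_prefixCode, Finset.mem_filter, Finset.mem_range, Bool.and_eq_true,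
    decide_eq_true_eq]
  exact ⟨fun h => h.2.2, fun h => ⟨Finset.mem_range.1 (hX h), Finset.mem_range.1 (hX h), h⟩⟩

theorem count_div_mod_eq_card {N : ℕ} {p q : ℕ → Bool} {r : ℕ → ℕ → Bool} :
    Nat.count (fun k => (p (k / N) && q (k % N) && r (k / N) (k % N)) = true) (N * N) =
      ((((Finset.range N).filter fun u => p u = true) ×ˢ
        ((Finset.range N).filter fun u => q u = true)).filter
          fun a => r a.1 a.2 = true).card := by
  rw [Nat.count_eq_card_filter_range]
  refine Finset.card_bij' (fun k _ => (k / N, k % N)) (fun a _ => N * a.1 + a.2) ?_ ?_ ?_ ?_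
  · intro k hk
    simp only [Finset.mem_filter, Finset.mem_range, Bool.and_eq_true, Finset.mem_product] at hk ⊢
    have hN : 0 < N := Nat.pos_of_ne_zero fun h => by simp [h] at hk
    exact ⟨⟨⟨Nat.div_lt_of_lt_mul hk.1, hk.2.1.1⟩, Nat.mod_lt _ hN, hk.2.1.2⟩, hk.2.2⟩
  · rintro ⟨u, v⟩ ha
    simp only [Finset.mem_filter, Finset.mem_range, Bool.and_eq_true, Finset.mem_product] at ha ⊢
    have hN : 0 < N := by omega
    have h1 : (N * u + v) / N = u := by
      rw [Nat.mul_add_div hN, Nat.div_eq_of_lt ha.1.2.1, add_zero]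
    have h2 : (N * u + v) % N = v := by
      rw [Nat.mul_add_mod, Nat.mod_eq_of_lt ha.1.2.1]
    rw [h1, h2]
    refine ⟨?_, ⟨ha.1.1.2, ha.1.2.2⟩, ha.2⟩
    calc N * u + v < N * u + N := by omega
      _ = N * (u + 1) := by ring
      _ ≤ N * N := Nat.mul_le_mul_left _ ha.1.1.1
  · intro k _
    exact Nat.div_add_mod k N
  · rintro ⟨u, v⟩ ha
    simp only [Finset.mem_filter, Finset.mem_range, Finset.mem_product] at ha
    have hN : 0 < N := by omega
    simp [Nat.mul_add_div hN, Nat.div_eq_of_lt ha.1.2.1, Nat.mod_eq_of_lt ha.1.2.1]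

/-- The function with a given code. -/
def tableValue (n m c u v : ℕ) : ℕ := (decodeD (List ℕ) c).getD (2 ^ n * u + v) 0 % 2 ^ m

/-- A decision procedure for `IsBalanced`. -/
def checkBalanced (n m c : ℕ) : Bool :=
  allBelow (fun ξ => allBelow (fun η => allBelow (fun b =>
    decide (Nat.count (fun k => (ξ.testBit (k / 2 ^ n) && η.testBit (k % 2 ^ n) &&
        decide (tableValue n m c (k / 2 ^ n) (k % 2 ^ n) = b)) = true) (2 ^ n * 2 ^ n) <
      2 * (Nat.count (fun u => ξ.testBit u = true) (2 ^ n) *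
        Nat.count (fun u => η.testBit u = true) (2 ^ n) / 2 ^ m + 1) +
      (n + m + 4) * (Nat.count (fun u => ξ.testBit u = true) (2 ^ n) +
        Nat.count (fun u => η.testBit u = true) (2 ^ n) + 1)))
    (2 ^ m)) (2 ^ 2 ^ n)) (2 ^ 2 ^ n)

theorem checkBalanced_iff {n m c : ℕ} :
    checkBalanced n m c = true ↔ IsBalanced n m (tableValue n m c) := by
  unfold checkBalanced IsBalanced
  have key : ∀ ξ η b : ℕ, Nat.count (fun k => (ξ.testBit (k / 2 ^ n) && η.testBit (k % 2 ^ n) &&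
        decide (tableValue n m c (k / 2 ^ n) (k % 2 ^ n) = b)) = true) (2 ^ n * 2 ^ n) =
      ((((Finset.range (2 ^ n)).filter fun u => ξ.testBit u = true) ×ˢ
        ((Finset.range (2 ^ n)).filter fun u => η.testBit u = true)).filter
          fun a => tableValue n m c a.1 a.2 = b).card := by
    intro ξ η b
    rw [count_div_mod_eq_card (r := fun u v => decide (tableValue n m c u v = b))]
    simp only [decide_eq_true_eq]
  simp only [allBelow_iff, key, decide_eq_true_eq]
  simp only [Nat.count_eq_card_filter_range]
  constructor
  · intro h X hX Y hY b hb
    have h1 := h _ (prefixCode_lt (fun u => decide (u ∈ X)) _) _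
      (prefixCode_lt (fun u => decide (u ∈ Y)) _) b hb
    rwa [filter_range_testBit_prefixCode hX, filter_range_testBit_prefixCode hY] at h1
  · intro h ξ _ η _ b hb
    exact h _ (Finset.filter_subset _ _) _ (Finset.filter_subset _ _) b hb

theorem exists_checkBalanced (n m : ℕ) : ∃ c, checkBalanced n m c = true := by
  obtain ⟨e, he, hb⟩ := exists_isBalanced n m
  refine ⟨Encodable.encode ((List.range (2 ^ n * 2 ^ n)).map
    fun k => e (k / 2 ^ n) (k % 2 ^ n)), checkBalanced_iff.2 (hb.congr fun u hu v hv => ?_)⟩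
  have hN : 0 < 2 ^ n := by positivity
  have h1 : 2 ^ n * u + v < 2 ^ n * 2 ^ n := by
    calc 2 ^ n * u + v < 2 ^ n * u + 2 ^ n := by omega
      _ = 2 ^ n * (u + 1) := by ring
      _ ≤ 2 ^ n * 2 ^ n := Nat.mul_le_mul_left _ hu
  unfold tableValue
  rw [decodeD_encode, List.getD_eq_getElem _ _ (by simpa using h1)]
  simp [Nat.mul_add_div hN, Nat.div_eq_of_lt hv, Nat.mod_eq_of_lt hv, Nat.mod_eq_of_lt (he _ _)]

/-- Balanced functions can be computed, uniformly in the lengths of the strings. -/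
theorem exists_isComputable_isBalanced {n m : ℕ → ℕ} (hn : IsComputable n) (hm : IsComputable m) :
    ∃ E : ℕ × ℕ × ℕ → ℕ, IsComputable E ∧ ∀ i, (∀ u v, E (i, u, v) < 2 ^ m i) ∧
      IsBalanced (n i) (m i) fun u v => E (i, u, v) := by
  have h : ∀ i, ∃ c, checkBalanced (n i) (m i) c = true := fun i => exists_checkBalanced _ _
  -- The probabilistic existence proof only guarantees that the search for a balanced table
  -- terminates.
  let c : ℕ → ℕ := fun i => Nat.find (h i)
  have hc : IsComputable c := by
    have h1 : IsComputable fun a : ℕ × ℕ => checkBalanced (n a.1) (m a.1) a.2 := by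
      unfold checkBalanced tableValue
      fun_prop
    refine ⟨(Partrec.rfind (p := fun i k => Part.some (checkBalanced (n i) (m i) k))
      h1.out.partrec.to₂).of_eq_tot fun i => ?_⟩
    refine Nat.mem_rfind.2 ⟨?_, fun {k} hk => ?_⟩
    · exact Part.mem_some_iff.2 (Nat.find_spec (h i)).symm
    · exact Part.mem_some_iff.2 (by simpa using (Nat.find_min (h i) hk))
  refine ⟨fun a => tableValue (n a.1) (m a.1) (c a.1) a.2.1 a.2.2, ?_, fun i => ⟨fun u v => ?_,
    checkBalanced_iff.1 (Nat.find_spec (h i))⟩⟩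
  · unfold tableValue
    fun_prop
  · exact Nat.mod_lt _ (by positivity)

/-! ### Counting in rectangles -/

/-- The additive errors are absorbed into the two factors, so that the bound remains a product and
can be summed over the residues of both arguments separately. -/
theorem IsBalanced.card_mul_le {n m : ℕ} {e : ℕ → ℕ → ℕ} (he : IsBalanced n m e) {X Y : Finset ℕ}
    (hX : X ⊆ Finset.range (2 ^ n)) (hY : Y ⊆ Finset.range (2 ^ n)) {b : ℕ} (hb : b < 2 ^ m) :
    ((X ×ˢ Y).filter fun p => e p.1 p.2 = b).card * 2 ^ m ≤
      2 * ((X.card + (n + m + 4) * 2 ^ m) * (Y.card + (n + m + 4) * 2 ^ m)) := by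
  have h1 := (he X hX Y hY b hb).le
  have h2 : X.card * Y.card / 2 ^ m * 2 ^ m ≤ X.card * Y.card := Nat.div_mul_le_self _ _
  set D := 2 ^ m
  set κ := n + m + 4 with hκ
  have hκ4 : 4 ≤ κ := by omega
  have hD : 1 ≤ D := Nat.one_le_two_pow
  set q := X.card * Y.card / D
  have h3 : 2 * D + κ * D ≤ 2 * (κ * D) * (κ * D) := by nlinarith [Nat.mul_le_mul hκ4 hD]
  calc _ ≤ (2 * (q + 1) + κ * (X.card + Y.card + 1)) * D := Nat.mul_le_mul_right _ h1
    _ = 2 * (q * D) + κ * D * (X.card + Y.card) + (2 * D + κ * D) := by ring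
    _ ≤ 2 * (X.card * Y.card) + κ * D * (X.card + Y.card) + 2 * (κ * D) * (κ * D) := by gcongr
    _ ≤ _ := by nlinarith [Nat.zero_le (κ * D * (X.card + Y.card))]

theorem sum_card_filter_mod_add (X : Finset ℕ) {P : ℕ} (hP : 0 < P) (K : ℕ) :
    ∑ p ∈ Finset.range P, ((X.filter fun u => u % P = p).card + K) = X.card + P * K := by
  rw [Finset.sum_add_distrib, ← Finset.card_eq_sum_card_fiberwise
    (fun u _ => Finset.mem_coe.2 (Finset.mem_range.2 (Nat.mod_lt u hP)))]
  simp

/-- A balanced function hits sparse sets rarely, even if these depend on residues of the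
arguments. -/
theorem IsBalanced.card_filter_mem_mul_le {n m g P : ℕ} {e : ℕ → ℕ → ℕ} (he : IsBalanced n m e)
    {X Y : Finset ℕ} (hX : X ⊆ Finset.range (2 ^ n)) (hY : Y ⊆ Finset.range (2 ^ n)) (hP : 0 < P)
    {A : ℕ → ℕ → Finset ℕ} (hA : ∀ p q, A p q ⊆ Finset.range (2 ^ m))
    (hAg : ∀ p q, (A p q).card * 2 ^ g ≤ 2 ^ m) :
    ((X ×ˢ Y).filter fun a => e a.1 a.2 ∈ A (a.1 % P) (a.2 % P)).card * 2 ^ g ≤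
      2 * ((X.card + P * ((n + m + 4) * 2 ^ m)) * (Y.card + P * ((n + m + 4) * 2 ^ m))) := by
  set W := (X ×ˢ Y).filter fun a => e a.1 a.2 ∈ A (a.1 % P) (a.2 % P) with hW
  let Xp : ℕ → Finset ℕ := fun p => X.filter fun u => u % P = p
  let Yp : ℕ → Finset ℕ := fun p => Y.filter fun u => u % P = p
  set K := (n + m + 4) * 2 ^ m with hK
  have h1 : W.card = ∑ p ∈ Finset.range P ×ˢ Finset.range P,
      (W.filter fun a => (a.1 % P, a.2 % P) = p).card := by
    refine Finset.card_eq_sum_card_fiberwise fun a _ => ?_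
    simp [Nat.mod_lt _ hP]
  -- For fixed residues the arguments still form a rectangle and the sparse set is constant, so the
  -- balance bound applies to each of its elements.
  have h2 : ∀ p : ℕ × ℕ, (W.filter fun a => (a.1 % P, a.2 % P) = p).card ≤
      ∑ b ∈ A p.1 p.2, ((Xp p.1 ×ˢ Yp p.2).filter fun a => e a.1 a.2 = b).card := by
    intro p
    refine le_trans (Finset.card_le_card ?_) Finset.card_biUnion_le
    rintro ⟨u, v⟩ ha
    simp only [hW, Finset.mem_filter, Finset.mem_product] at ha
    obtain ⟨⟨⟨hu, hv⟩, hm⟩, rfl⟩ := ha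
    simp only [Xp, Yp, Finset.mem_biUnion, Finset.mem_filter, Finset.mem_product]
    exact ⟨_, hm, ⟨⟨hu, trivial⟩, hv, trivial⟩, rfl⟩
  have h3 : ∀ p : ℕ × ℕ, (W.filter fun a => (a.1 % P, a.2 % P) = p).card * 2 ^ g * 2 ^ m ≤
      2 ^ m * (2 * (((Xp p.1).card + K) * ((Yp p.2).card + K))) := by
    intro p
    calc _ ≤ (∑ b ∈ A p.1 p.2, ((Xp p.1 ×ˢ Yp p.2).filter fun a => e a.1 a.2 = b).card) *
          2 ^ g * 2 ^ m := by gcongr; exact h2 p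
      _ = (∑ b ∈ A p.1 p.2, ((Xp p.1 ×ˢ Yp p.2).filter fun a => e a.1 a.2 = b).card * 2 ^ m) *
          2 ^ g := by rw [← Finset.sum_mul]; ring
      _ ≤ (∑ b ∈ A p.1 p.2, 2 * (((Xp p.1).card + K) * ((Yp p.2).card + K))) * 2 ^ g := by
          refine Nat.mul_le_mul_right _ (Finset.sum_le_sum fun b hb => ?_)
          exact he.card_mul_le ((Finset.filter_subset _ _).trans hX)
            ((Finset.filter_subset _ _).trans hY) (Finset.mem_range.1 (hA _ _ hb))
      _ = ((A p.1 p.2).card * 2 ^ g) * (2 * (((Xp p.1).card + K) * ((Yp p.2).card + K))) := by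
          rw [Finset.sum_const, smul_eq_mul]; ring
      _ ≤ _ := by gcongr; exact hAg _ _
  refine Nat.le_of_mul_le_mul_right (c := 2 ^ m) ?_ (by positivity)
  calc W.card * 2 ^ g * 2 ^ m
      = ∑ p ∈ Finset.range P ×ˢ Finset.range P,
        (W.filter fun a => (a.1 % P, a.2 % P) = p).card * 2 ^ g * 2 ^ m := by
        rw [h1, Finset.sum_mul, Finset.sum_mul]
    _ ≤ ∑ p ∈ Finset.range P ×ˢ Finset.range P,
        2 ^ m * (2 * (((Xp p.1).card + K) * ((Yp p.2).card + K))) :=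
        Finset.sum_le_sum fun p _ => h3 p
    _ = 2 ^ m * (2 * ((∑ p ∈ Finset.range P, ((Xp p).card + K)) *
          ∑ p ∈ Finset.range P, ((Yp p).card + K))) := by
        rw [← Finset.mul_sum, ← Finset.mul_sum, Finset.sum_mul_sum, Finset.sum_product]
    _ = _ := by
        rw [sum_card_filter_mod_add X hP, sum_card_filter_mod_add Y hP]; ring

/-! ### The layout of the output sequence -/

/-- The first position of the `i`-th block of the output. -/
def blockStart (i : ℕ) : ℕ := 2 ^ (i * i) - 1

/-- The length of the `i`-th block of the output. -/
def blockLen (i : ℕ) : ℕ := blockStart (i + 1) - blockStart i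

/-- The length of the initial segments on which the `i`-th block of the output depends. -/
def inputLen (i : ℕ) : ℕ := 2 ^ ((i + 1) * (i + 1) + i)

/-- The block to which a position of the output belongs. -/
def blockOf (p : ℕ) : ℕ := Nat.count (fun i => decide (blockStart (i + 1) ≤ p) = true) (p + 1)

@[fun_prop]
theorem isComputable_blockStart : IsComputable blockStart := by
  unfold blockStart; fun_prop

@[fun_prop]
theorem isComputable_blockLen : IsComputable blockLen := by
  unfold blockLen; fun_prop

@[fun_prop]
theorem isComputable_inputLen : IsComputable inputLen := by
  unfold inputLen; fun_prop

@[fun_prop]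
theorem isComputable_blockOf : IsComputable blockOf := by
  unfold blockOf; fun_prop

theorem blockStart_mono : Monotone blockStart := fun i j h => by
  have : 2 ^ (i * i) ≤ 2 ^ (j * j) := Nat.pow_le_pow_right two_pos (Nat.mul_le_mul h h)
  unfold blockStart
  omega

theorem le_blockStart (i : ℕ) : i ≤ blockStart i := by
  have h1 : i * i < 2 ^ (i * i) := Nat.lt_two_pow_self
  have h2 : i ≤ i * i := Nat.le_mul_self i
  unfold blockStart
  omega

theorem inputLen_mono : Monotone inputLen := fun i j h =>
  Nat.pow_le_pow_right two_pos (by gcongr)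

theorem blockStart_add_blockLen (i : ℕ) : blockStart i + blockLen i = blockStart (i + 1) := by
  have : blockStart i ≤ blockStart (i + 1) := blockStart_mono (Nat.le_succ i)
  unfold blockLen
  omega

theorem blockOf_eq {i p : ℕ} (h1 : blockStart i ≤ p) (h2 : p < blockStart (i + 1)) :
    blockOf p = i := by
  unfold blockOf
  rw [Nat.count_eq_card_filter_range]
  have h3 : (Finset.range (p + 1)).filter (fun k => decide (blockStart (k + 1) ≤ p) = true) =
      Finset.range i := by
    ext k
    simp only [Finset.mem_filter, Finset.mem_range, decide_eq_true_eq]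
    constructor
    · rintro ⟨-, h⟩
      by_contra hk
      have := blockStart_mono (show i + 1 ≤ k + 1 by omega)
      omega
    · intro hk
      have := blockStart_mono (show k + 1 ≤ i by omega)
      have := le_blockStart i
      exact ⟨by omega, by omega⟩
  rw [h3, Finset.card_range]

theorem exists_blockStart_le (p : ℕ) : ∃ i, blockStart i ≤ p ∧ p < blockStart (i + 1) := by
  classical
  have h : ∃ i, p < blockStart (i + 1) := ⟨p, (Nat.lt_succ_self p).trans_le (le_blockStart _)⟩
  refine ⟨Nat.find h, ?_, Nat.find_spec h⟩
  rcases Nat.eq_zero_or_pos (Nat.find h) with h0 | h0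
  · rw [h0]; simp [blockStart]
  · have := Nat.find_min h (m := Nat.find h - 1) (by omega)
    rw [Nat.sub_add_cancel h0] at this
    omega

section
variable (E : ℕ × ℕ × ℕ → ℕ)

/-- The output sequence: the `i`-th block is the value of `E` at initial segments of `x` and `y`. -/
def extract (x y : BinSeq) : BinSeq := fun p =>
  (E (blockOf p, prefixCode x (inputLen (blockOf p)), prefixCode y (inputLen (blockOf p)))).testBit
    (p - blockStart (blockOf p))

/-- The code of the first `i` blocks of the output, given codes of initial segments. -/
def outPrefix (i u v : ℕ) : ℕ :=
  ∑ l ∈ Finset.range i, 2 ^ blockStart l * E (l, u % 2 ^ inputLen l, v % 2 ^ inputLen l)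

variable {E}

theorem isComputable_outPrefix {α : Type*} [Primcodable α] (hE : IsComputable E) {i u v : α → ℕ}
    (hi : IsComputable i) (hu : IsComputable u) (hv : IsComputable v) :
    IsComputable fun a => outPrefix E (i a) (u a) (v a) := by
  unfold outPrefix
  fun_prop

/-- Blocks up to the `i`-th read no input beyond `inputLen i`. Hence a set that depends on these
blocks depends only on residues, as `IsBalanced.card_filter_mem_mul_le` requires. -/
theorem outPrefix_mod (i u v : ℕ) :
    outPrefix E (i + 1) (u % 2 ^ inputLen i) (v % 2 ^ inputLen i) = outPrefix E (i + 1) u v := by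
  unfold outPrefix
  refine Finset.sum_congr rfl fun l hl => ?_
  have h1 : 2 ^ inputLen l ∣ 2 ^ inputLen i :=
    pow_dvd_pow 2 (inputLen_mono (Nat.lt_succ_iff.1 (Finset.mem_range.1 hl)))
  rw [Nat.mod_mod_of_dvd _ h1, Nat.mod_mod_of_dvd _ h1]

theorem prefixCode_add (x : ℕ → Bool) (a j : ℕ) :
    prefixCode x (a + j) = prefixCode x a + 2 ^ a * prefixCode (fun p => x (a + p)) j := by
  unfold prefixCode
  rw [Finset.sum_range_add, Finset.mul_sum]
  congr 1
  refine Finset.sum_congr rfl fun p _ => ?_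
  rw [pow_add]; ring

theorem prefixCode_extract_add (x y : BinSeq) {i j : ℕ} (hj : j ≤ blockLen i) :
    prefixCode (extract E x y) (blockStart i + j) = prefixCode (extract E x y) (blockStart i) +
      2 ^ blockStart i *
        (E (i, prefixCode x (inputLen i), prefixCode y (inputLen i)) % 2 ^ j) := by
  rw [prefixCode_add, ← prefixCode_testBit]
  congr 2
  refine prefixCode_congr fun p hp => ?_
  have h1 := blockStart_add_blockLen i
  have h2 : blockOf (blockStart i + p) = i := blockOf_eq (by omega) (by omega)
  simp [extract, h2]

theorem prefixCode_extract (hE : ∀ i u v, E (i, u, v) < 2 ^ blockLen i) (x y : BinSeq) {i N : ℕ}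
    (hN : ∀ l < i, inputLen l ≤ N) :
    prefixCode (extract E x y) (blockStart i) =
      outPrefix E i (prefixCode x N) (prefixCode y N) := by
  induction i with
  | zero => simp [blockStart, prefixCode, outPrefix]
  | succ i ih =>
    rw [← blockStart_add_blockLen, prefixCode_extract_add x y le_rfl,
      ih fun l hl => hN l (by omega), outPrefix, outPrefix, Finset.sum_range_succ,
      prefixCode_mod x (hN i (by omega)), prefixCode_mod y (hN i (by omega)),
      Nat.mod_eq_of_lt (hE _ _ _)]

end

/-! ### Values in sparse sets make the joint complexity drop -/

theorem initSeg_testBit_injOn (n : ℕ) {u v : ℕ} (hu : u < 2 ^ n) (hv : v < 2 ^ n)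
    (h : initSeg u.testBit n = initSeg v.testBit n) : u = v := by
  have := congrArg listCode h
  rwa [listCode_initSeg, listCode_initSeg, prefixCode_testBit, prefixCode_testBit,
    Nat.mod_eq_of_lt hu, Nat.mod_eq_of_lt hv] at this

theorem natPair_lt_two_pow {a b s : ℕ} (ha : a < 2 ^ s) (hb : b < 2 ^ s) :
    Nat.pair a b < 2 ^ (2 * s) := by
  calc Nat.pair a b < (max a b + 1) ^ 2 := Nat.pair_lt_max_add_one_sq _ _
    _ ≤ (2 ^ s) ^ 2 := by gcongr; exact max_lt ha hb
    _ = 2 ^ (2 * s) := by rw [← pow_mul, mul_comm]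

theorem exists_finset_initSeg_complexity_le (M : List Bool →. List Bool) (n k : ℕ) :
    ∃ X ⊆ Finset.range (2 ^ n), X.card ≤ 2 ^ (k + 1) ∧
      ∀ u < 2 ^ n, complexity M (initSeg u.testBit n) ≤ k → u ∈ X := by
  classical
  obtain ⟨F, hF, hFc⟩ := exists_finset_complexity_le M k
  refine ⟨(Finset.range (2 ^ n)).filter fun u => initSeg u.testBit n ∈ F,
    Finset.filter_subset _ _, le_trans ?_ hFc, fun u hu h =>
      Finset.mem_filter.2 ⟨Finset.mem_range.2 hu, hF _ h⟩⟩
  refine Finset.card_le_card_of_injOn (fun u => initSeg u.testBit n)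
    (fun u hu => (Finset.mem_filter.1 hu).2) fun u hu v hv h => ?_
  exact initSeg_testBit_injOn n (Finset.mem_range.1 (Finset.mem_filter.1 hu).1)
    (Finset.mem_range.1 (Finset.mem_filter.1 hv).1) h

section
variable {U : List Bool →. List Bool} {E : ℕ × ℕ × ℕ → ℕ} {R : ℕ × ℕ × ℕ → Prop}

theorem rePred_sparse_event (hU : Partrec U) (hE : IsComputable E) (hR : REPred R) :
    REPred fun a : ((ℕ × ℕ) × ℕ × ℕ) × ℕ × ℕ =>
      complexity U (initSeg a.2.1.testBit (inputLen (a.1.1.1 + 1))) ≤ a.1.2.1 ∧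
      complexity U (initSeg a.2.2.testBit (inputLen (a.1.1.1 + 1))) ≤ a.1.2.2 ∧
      R (a.1.1.2, outPrefix E (a.1.1.1 + 1) a.2.1 a.2.2, E (a.1.1.1 + 1, a.2.1, a.2.2)) := by
  have h1 : REPred fun a : ((ℕ × ℕ) × ℕ × ℕ) × ℕ × ℕ =>
      complexity U (initSeg a.2.1.testBit (inputLen (a.1.1.1 + 1))) ≤ a.1.2.1 :=
    rePred_comp (rePred_complexity_le hU) (f := fun a : ((ℕ × ℕ) × ℕ × ℕ) × ℕ × ℕ =>
      (a.1.2.1, initSeg a.2.1.testBit (inputLen (a.1.1.1 + 1)))) (by fun_prop)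
  have h2 : REPred fun a : ((ℕ × ℕ) × ℕ × ℕ) × ℕ × ℕ =>
      complexity U (initSeg a.2.2.testBit (inputLen (a.1.1.1 + 1))) ≤ a.1.2.2 :=
    rePred_comp (rePred_complexity_le hU) (f := fun a : ((ℕ × ℕ) × ℕ × ℕ) × ℕ × ℕ =>
      (a.1.2.2, initSeg a.2.2.testBit (inputLen (a.1.1.1 + 1)))) (by fun_prop)
  have h3 : REPred fun a : ((ℕ × ℕ) × ℕ × ℕ) × ℕ × ℕ =>
      R (a.1.1.2, outPrefix E (a.1.1.1 + 1) a.2.1 a.2.2, E (a.1.1.1 + 1, a.2.1, a.2.2)) := by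
    refine rePred_comp hR (f := fun a : ((ℕ × ℕ) × ℕ × ℕ) × ℕ × ℕ =>
      (a.1.1.2, outPrefix E (a.1.1.1 + 1) a.2.1 a.2.2, E (a.1.1.1 + 1, a.2.1, a.2.2))) ?_
    refine isComputable_prodMk (by fun_prop) (isComputable_prodMk
      (isComputable_outPrefix hE (by fun_prop) (by fun_prop) (by fun_prop)) (by fun_prop))
  exact rePred_and h1 (rePred_and h2 h3)

/-- If the value of `E` at `(u, v)` lies in a set, out of a recursively enumerable family, that
depends only on the preceding blocks and has density at most `2 ^ (-g)`, then the complexity of `uv`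
is smaller by about `g` than the sum of the complexities. -/
theorem exists_complexity_append_add_le (hU : IsUniversal U) (hE : IsComputable E)
    (hEb : ∀ i, IsBalanced (inputLen i) (blockLen i) fun u v => E (i, u, v))
    (hElt : ∀ i u v, E (i, u, v) < 2 ^ blockLen i) (hR : REPred R) :
    ∃ C : ℕ, ∀ i q g kx ky u v s : ℕ,
      u < 2 ^ inputLen (i + 1) → v < 2 ^ inputLen (i + 1) →
      complexity U (initSeg u.testBit (inputLen (i + 1))) ≤ kx →
      complexity U (initSeg v.testBit (inputLen (i + 1))) ≤ ky →
      2 ^ inputLen i * ((inputLen (i + 1) + blockLen (i + 1) + 4) * 2 ^ blockLen (i + 1))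
        ≤ 2 ^ kx →
      2 ^ inputLen i * ((inputLen (i + 1) + blockLen (i + 1) + 4) * 2 ^ blockLen (i + 1))
        ≤ 2 ^ ky →
      (∀ a, ∃ F : Finset ℕ, (∀ b < 2 ^ blockLen (i + 1), R (q, a, b) → b ∈ F) ∧
        F.card * 2 ^ g ≤ 2 ^ blockLen (i + 1)) →
      R (q, outPrefix E (i + 1) u v, E (i + 1, u, v)) →
      i < 2 ^ s → q < 2 ^ s → kx < 2 ^ s → ky < 2 ^ s →
      complexity U (initSeg u.testBit (inputLen (i + 1)) ++ initSeg v.testBit (inputLen (i + 1)))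
        + g ≤ (kx + ky + 8 * s + C : ℕ) := by
  let S : ℕ × List Bool → Prop := fun a => ∃ t : ℕ × ℕ,
    (decide (t.1 < 2 ^ inputLen (a.1.unpair.1.unpair.1 + 1)) &&
      decide (t.2 < 2 ^ inputLen (a.1.unpair.1.unpair.1 + 1)) &&
      decide (a.2 = initSeg t.1.testBit (inputLen (a.1.unpair.1.unpair.1 + 1)) ++
        initSeg t.2.testBit (inputLen (a.1.unpair.1.unpair.1 + 1)))) = true ∧
    complexity U (initSeg t.1.testBit (inputLen (a.1.unpair.1.unpair.1 + 1)))
      ≤ a.1.unpair.2.unpair.1 ∧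
    complexity U (initSeg t.2.testBit (inputLen (a.1.unpair.1.unpair.1 + 1)))
      ≤ a.1.unpair.2.unpair.2 ∧
    R (a.1.unpair.1.unpair.2, outPrefix E (a.1.unpair.1.unpair.1 + 1) t.1 t.2,
      E (a.1.unpair.1.unpair.1 + 1, t.1, t.2))
  have hS : REPred S := by
    refine rePred_exists (P := fun a : (ℕ × List Bool) × ℕ × ℕ => _) (rePred_and
      (rePred_of_isComputable (T := fun a : (ℕ × List Bool) × ℕ × ℕ =>
        (decide (a.2.1 < 2 ^ inputLen (a.1.1.unpair.1.unpair.1 + 1)) &&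
        decide (a.2.2 < 2 ^ inputLen (a.1.1.unpair.1.unpair.1 + 1)) &&
        decide (a.1.2 = initSeg a.2.1.testBit (inputLen (a.1.1.unpair.1.unpair.1 + 1)) ++
          initSeg a.2.2.testBit (inputLen (a.1.1.unpair.1.unpair.1 + 1))))) (by fun_prop))
      (rePred_comp (rePred_sparse_event hU.1 hE hR) (f := fun a : (ℕ × List Bool) × ℕ × ℕ =>
        (((a.1.1.unpair.1.unpair.1, a.1.1.unpair.1.unpair.2),
          (a.1.1.unpair.2.unpair.1, a.1.1.unpair.2.unpair.2)), a.2)) (by fun_prop)))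
  obtain ⟨c, hc⟩ := exists_complexity_le_of_card_le hU hS
  refine ⟨c + 5, fun i q g kx ky u v s hu hv hKu hKv htx hty hF hRuv hi hq hx hy => ?_⟩
  classical
  choose F hFR hFc using hF
  set n := inputLen (i + 1) with hn
  set m := blockLen (i + 1) with hm
  obtain ⟨X, hXr, hXc, hX⟩ := exists_finset_initSeg_complexity_le U n kx
  obtain ⟨Y, hYr, hYc, hY⟩ := exists_finset_initSeg_complexity_le U n ky
  let A : ℕ → ℕ → Finset ℕ := fun p p' =>
    (F (outPrefix E (i + 1) p p')).filter fun b => b < 2 ^ m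
  let W := (X ×ˢ Y).filter fun a =>
    E (i + 1, a.1, a.2) ∈ A (a.1 % 2 ^ inputLen i) (a.2 % 2 ^ inputLen i)
  have hW : W.card * 2 ^ g ≤ 2 ^ (kx + ky + 5) := by
    refine ((hEb (i + 1)).card_filter_mem_mul_le (g := g) hXr hYr (by positivity)
      (fun p p' b hb => Finset.mem_range.2 (Finset.mem_filter.1 hb).2) fun p p' =>
        (Nat.mul_le_mul_right _ (Finset.card_le_card (Finset.filter_subset _ _))).trans
          (hFc _)).trans ?_
    -- The right side is `18 * 2 ^ (kx + ky)`, and `18 ≤ 2 ^ 5`.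
    calc _ ≤ 2 * ((2 ^ (kx + 1) + 2 ^ kx) * (2 ^ (ky + 1) + 2 ^ ky)) := by gcongr
      _ ≤ 2 ^ (kx + ky + 5) := by
        rw [pow_succ 2 kx, pow_succ 2 ky, pow_add, pow_add]
        nlinarith [Nat.zero_le (2 ^ kx * 2 ^ ky)]
  -- The four parameters take at most `4 * s` bits together; their self-delimiting description costs
  -- the `8 * s` in the conclusion.
  let Q := Nat.pair (Nat.pair i q) (Nat.pair kx ky)
  have hQ : Q < 2 ^ (2 * (2 * s)) :=
    natPair_lt_two_pow (natPair_lt_two_pow hi hq) (natPair_lt_two_pow hx hy)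
  have h1 := hc Q (initSeg u.testBit n ++ initSeg v.testBit n) g (kx + ky + 5)
    (W.image fun t => initSeg t.1.testBit n ++ initSeg t.2.testBit n) ?_ ?_
    ((Nat.mul_le_mul_right _ Finset.card_image_le).trans hW)
  · refine h1.trans ?_
    have h2 := Nat.size_le.2 hQ
    exact_mod_cast (by omega)
  · refine ⟨(u, v), ?_⟩
    simp only [Q, Nat.unpair_pair, Bool.and_eq_true, decide_eq_true_eq]
    exact ⟨⟨⟨hu, hv⟩, rfl⟩, hKu, hKv, hRuv⟩
  · rintro w ⟨⟨u', v'⟩, h2⟩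
    simp only [Q, Nat.unpair_pair, Bool.and_eq_true, decide_eq_true_eq] at h2
    obtain ⟨⟨⟨hu', hv'⟩, rfl⟩, hKu', hKv', hR'⟩ := h2
    refine Finset.mem_image.2 ⟨(u', v'), Finset.mem_filter.2 ⟨Finset.mem_product.2
      ⟨hX _ hu' hKu', hY _ hv' hKv'⟩, Finset.mem_filter.2 ⟨?_, hElt _ _ _⟩⟩, rfl⟩
    rw [outPrefix_mod]
    exact hFR _ _ (hElt _ _ _) hR'

end

theorem le_inputLen (i : ℕ) : i ≤ inputLen i := by
  have h1 : (i + 1) * (i + 1) + i < inputLen i := Nat.lt_two_pow_self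
  omega

theorem blockLen_le (i : ℕ) : blockLen i ≤ 2 ^ ((i + 1) * (i + 1)) :=
  (Nat.sub_le _ _).trans (Nat.sub_le _ _)

/-- The entropy that `E` needs is sublinear in the length of the initial segments. -/
theorem entropy_le_two_pow {c i k : ℕ} (hi : 6 * (c + 1) ≤ i)
    (hk : inputLen (i + 1) ≤ (c + 1) * k) :
    2 ^ inputLen i * ((inputLen (i + 1) + blockLen (i + 1) + 4) * 2 ^ blockLen (i + 1))
      ≤ 2 ^ k := by
  set B := (i + 1 + 1) * (i + 1 + 1) with hB
  have hB1 : B < 2 ^ B := Nat.lt_two_pow_self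
  have h1 : inputLen (i + 1) = 2 ^ (B + (i + 1)) := rfl
  have h2 : blockLen (i + 1) ≤ 2 ^ B := blockLen_le (i + 1)
  have h3 : inputLen i ≤ 2 ^ B := by
    refine Nat.pow_le_pow_right two_pos ?_
    rw [hB]; ring_nf; omega
  have h4 : inputLen (i + 1) + blockLen (i + 1) + 4 ≤ 2 ^ (4 * 2 ^ B) := by
    have h5 : 2 ^ B ≤ 2 ^ (B + (i + 1)) := Nat.pow_le_pow_right two_pos (by omega)
    have h6 : 4 ≤ 2 ^ (B + (i + 1)) := by
      calc 4 = 2 ^ 2 := rfl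
        _ ≤ _ := Nat.pow_le_pow_right two_pos (by rw [hB]; nlinarith)
    calc inputLen (i + 1) + blockLen (i + 1) + 4 ≤ 2 ^ (B + (i + 1) + 2) := by
          rw [pow_succ _ (B + (i + 1) + 1), pow_succ _ (B + (i + 1)), h1]; omega
      _ ≤ _ := Nat.pow_le_pow_right two_pos (by
        have h7 : i + 3 ≤ 3 * B := by rw [hB]; nlinarith
        omega)
  -- The factor `2 ^ (i + 1)` by which the input length exceeds `2 ^ B` outgrows the constant `6 *
  -- (c + 1)`. The `6` collects the exponents `1 + 4 + 1` of the three factors on the left.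
  have h5 : 6 * 2 ^ B ≤ k := by
    have h6 : 6 * (c + 1) ≤ 2 ^ (i + 1) := (hi.trans (by omega)).trans Nat.lt_two_pow_self.le
    have h7 : (c + 1) * (6 * 2 ^ B) ≤ (c + 1) * k := by
      calc (c + 1) * (6 * 2 ^ B) = 6 * (c + 1) * 2 ^ B := by ring
        _ ≤ 2 ^ (i + 1) * 2 ^ B := by gcongr
        _ = inputLen (i + 1) := by rw [h1, ← pow_add, add_comm]
        _ ≤ _ := hk
    exact Nat.le_of_mul_le_mul_left h7 (by omega)
  calc _ ≤ 2 ^ 2 ^ B * (2 ^ (4 * 2 ^ B) * 2 ^ 2 ^ B) := by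
        gcongr <;> norm_num
    _ = 2 ^ (6 * 2 ^ B) := by rw [← pow_add, ← pow_add]; congr 1; ring
    _ ≤ 2 ^ k := Nat.pow_le_pow_right two_pos h5

/-! ### Independence bounds the sparsity of a block -/

section
variable {U : List Bool →. List Bool} {E : ℕ × ℕ × ℕ → ℕ} {R : ℕ × ℕ × ℕ → Prop} {x y : BinSeq}

/-- Blocks of the output for independent sources of positive dimension do not lie in sparse sets. -/
theorem exists_density_le (hU : IsUniversal U) (hE : IsComputable E)
    (hEb : ∀ i, IsBalanced (inputLen i) (blockLen i) fun u v => E (i, u, v))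
    (hElt : ∀ i u v, E (i, u, v) < 2 ^ blockLen i) (hxy : Independent U x y) {c N : ℕ}
    (hx : ∀ n, N ≤ n → ∀ k : ℕ, complexity U (initSeg x n) ≤ k → n ≤ (c + 1) * k)
    (hy : ∀ n, N ≤ n → ∀ k : ℕ, complexity U (initSeg y n) ≤ k → n ≤ (c + 1) * k)
    (hR : REPred R) :
    ∃ C I : ℕ, ∀ i q g s : ℕ, I ≤ i → i < 2 ^ s → q < 2 ^ s → inputLen (i + 1) < 2 ^ s →
      (∀ a, ∃ F : Finset ℕ, (∀ b < 2 ^ blockLen (i + 1), R (q, a, b) → b ∈ F) ∧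
        F.card * 2 ^ g ≤ 2 ^ blockLen (i + 1)) →
      R (q, outPrefix E (i + 1) (prefixCode x (inputLen (i + 1)))
        (prefixCode y (inputLen (i + 1))),
        E (i + 1, prefixCode x (inputLen (i + 1)), prefixCode y (inputLen (i + 1)))) →
      g ≤ C * (s + 1) := by
  obtain ⟨C₀, hC₀⟩ := hxy
  obtain ⟨C₁, hC₁⟩ := exists_complexity_append_add_le hU hE hEb hElt hR
  obtain ⟨d, hd⟩ := exists_complexity_le_length_add hU
  refine ⟨2 * C₀ + 8 * (d + 1) + C₁, N + 6 * (c + 1), fun i q g s hi his hqs hns hF hRi => ?_⟩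
  set n := inputLen (i + 1) with hn
  have hNn : N ≤ n := by have := le_inputLen (i + 1); omega
  -- Finiteness allows `kx + ky` to be cancelled later, and the bound keeps both numbers below `2 ^
  -- (s + d + 1)`.
  have hfin : ∀ o : BinSeq, ∃ k : ℕ, complexity U (initSeg o n) = k ∧ k ≤ n + d := by
    intro o
    have h1 := hd (initSeg o n)
    rw [length_initSeg] at h1
    obtain ⟨k, hk⟩ := ENat.ne_top_iff_exists.1 (ne_top_of_le_ne_top (ENat.natCast_ne_top _) h1)
    exact ⟨k, hk.symm, by rw [← hk] at h1; exact_mod_cast h1⟩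
  obtain ⟨kx, hkx, hkxn⟩ := hfin x
  obtain ⟨ky, hky, hkyn⟩ := hfin y
  have hs : 2 ^ s + 2 ^ d ≤ 2 ^ (s + d + 1) := by
    have h1 : 2 ^ s ≤ 2 ^ (s + d) := Nat.pow_le_pow_right two_pos (by omega)
    have h2 : 2 ^ d ≤ 2 ^ (s + d) := Nat.pow_le_pow_right two_pos (by omega)
    rw [pow_succ]; omega
  have hd2 : d < 2 ^ d := Nat.lt_two_pow_self
  have h1 := hC₁ i q g kx ky (prefixCode x n) (prefixCode y n) (s + d + 1)
    (prefixCode_lt _ _) (prefixCode_lt _ _) (by rw [initSeg_prefixCode, hkx])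
    (by rw [initSeg_prefixCode, hky])
    (entropy_le_two_pow (c := c) (by omega) (hx n hNn kx hkx.le))
    (entropy_le_two_pow (c := c) (by omega) (hy n hNn ky hky.le)) hF hRi
    (by omega) (by omega) (by omega) (by omega)
  rw [initSeg_prefixCode, initSeg_prefixCode] at h1
  have h2 := hC₀ n n
  rw [hkx, hky] at h2
  have h3 : ((kx + ky + g : ℕ) : ℕ∞) ≤
      (kx + ky + 8 * (s + d + 1) + C₁ + C₀ * (Nat.log 2 n + Nat.log 2 n + 1) : ℕ) := by
    calc ((kx + ky + g : ℕ) : ℕ∞) = (kx : ℕ∞) + ky + g := by push_cast; rfl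
      _ ≤ complexity U (initSeg x n ++ initSeg y n) +
          (C₀ * (Nat.log 2 n + Nat.log 2 n + 1) : ℕ) + g := by gcongr
      _ = complexity U (initSeg x n ++ initSeg y n) + g +
          (C₀ * (Nat.log 2 n + Nat.log 2 n + 1) : ℕ) := by ring
      _ ≤ (kx + ky + 8 * (s + d + 1) + C₁ : ℕ) +
          (C₀ * (Nat.log 2 n + Nat.log 2 n + 1) : ℕ) := by gcongr
      _ = _ := by push_cast; rfl
  have h4 : kx + ky + g ≤
      kx + ky + 8 * (s + d + 1) + C₁ + C₀ * (Nat.log 2 n + Nat.log 2 n + 1) := by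
    exact_mod_cast h3
  have h5 : Nat.log 2 n ≤ s := (Nat.log_mono_right hns.le).trans (by simp)
  have h6 : C₀ * (Nat.log 2 n + Nat.log 2 n + 1) ≤ C₀ * (s + s + 1) := by gcongr
  nlinarith [Nat.zero_le (C₁ * s), Nat.zero_le (d * s), Nat.zero_le C₀]

/-! ### Sections of sparse sets of strings -/

section
variable (T : (ℕ × List Bool) × ℕ → Bool)

/-- The number of extensions by `j` bits, of the string with length `L` and code `a`, that are in
the `k`-th set at stage `t`. -/
def sectionCount (k L j a t : ℕ) : ℕ :=
  Nat.count (fun b => T ((k, initSeg (a + 2 ^ L * b).testBit (L + j)), t) = true) (2 ^ j)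

theorem isComputable_sectionCount {α : Type*} [Primcodable α] (hT : IsComputable T)
    {k L j a t : α → ℕ} (hk : IsComputable k) (hL : IsComputable L) (hj : IsComputable j)
    (ha : IsComputable a) (ht : IsComputable t) :
    IsComputable fun o => sectionCount T (k o) (L o) (j o) (a o) (t o) := by
  unfold sectionCount
  fun_prop

theorem card_le_mul_of_mod_mem {m j : ℕ} (hj : j ≤ m) {F G : Finset ℕ}
    (hF : ∀ b ∈ F, b < 2 ^ m ∧ b % 2 ^ j ∈ G) : F.card ≤ G.card * 2 ^ (m - j) := by
  have h1 : F ⊆ (G ×ˢ Finset.range (2 ^ (m - j))).image fun p => 2 ^ j * p.2 + p.1 := by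
    intro b hb
    obtain ⟨h2, h3⟩ := hF b hb
    refine Finset.mem_image.2 ⟨(b % 2 ^ j, b / 2 ^ j), Finset.mem_product.2 ⟨h3, ?_⟩,
      Nat.div_add_mod _ _⟩
    refine Finset.mem_range.2 (Nat.div_lt_of_lt_mul ?_)
    rwa [← pow_add, Nat.add_sub_cancel' hj]
  refine (Finset.card_le_card h1).trans (Finset.card_image_le.trans ?_)
  simp

variable {T}

/-- If a section is enumerated only while it is sparse, then what is enumerated is sparse. -/
theorem exists_finset_section (hTm : ∀ a s s', s ≤ s' → T (a, s) → T (a, s'))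
    {k L j g m : ℕ} (hj : j ≤ m) (a : ℕ) :
    ∃ F : Finset ℕ, (∀ b < 2 ^ m,
        (∃ t, T ((k, initSeg (a + 2 ^ L * (b % 2 ^ j)).testBit (L + j)), t) = true ∧
          sectionCount T k L j a t * 2 ^ g ≤ 2 ^ j) → b ∈ F) ∧
      F.card * 2 ^ g ≤ 2 ^ m := by
  classical
  let P : ℕ → ℕ → Prop := fun b t =>
    T ((k, initSeg (a + 2 ^ L * b).testBit (L + j)), t) = true ∧
      sectionCount T k L j a t * 2 ^ g ≤ 2 ^ j
  let G := (Finset.range (2 ^ j)).filter fun b => ∃ t, P b t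
  have hG : G.card * 2 ^ g ≤ 2 ^ j := by
    rcases G.eq_empty_or_nonempty with h0 | h0
    · simp [h0]
    have h1 : ∀ b, ∃ t, b ∈ G → P b t := fun b => by
      by_cases hb : b ∈ G
      · obtain ⟨t, ht⟩ := (Finset.mem_filter.1 hb).2
        exact ⟨t, fun _ => ht⟩
      · exact ⟨0, fun h => absurd h hb⟩
    choose t ht using h1
    -- At the stage of the element with the latest chosen stage, all others are already present, and
    -- the count at that stage is within the bound.
    obtain ⟨b₀, hb₀, hmax⟩ := Finset.exists_max_image G t h0
    refine (Nat.mul_le_mul_right _ ?_).trans (ht b₀ hb₀).2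
    unfold sectionCount
    rw [Nat.count_eq_card_filter_range]
    refine Finset.card_le_card fun b hb => Finset.mem_filter.2 ⟨(Finset.mem_filter.1 hb).1, ?_⟩
    exact hTm _ _ _ (hmax b hb) (ht b hb).1
  refine ⟨(Finset.range (2 ^ m)).filter fun b => ∃ t, P (b % 2 ^ j) t, fun b hb h =>
    Finset.mem_filter.2 ⟨Finset.mem_range.2 hb, h⟩, ?_⟩
  refine (Nat.mul_le_mul_right _ (card_le_mul_of_mod_mem (G := G) hj fun b hb =>
    ⟨Finset.mem_range.1 (Finset.mem_filter.1 hb).1, Finset.mem_filter.2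
      ⟨Finset.mem_range.2 (Nat.mod_lt _ (by positivity)), (Finset.mem_filter.1 hb).2⟩⟩)).trans ?_
  calc G.card * 2 ^ (m - j) * 2 ^ g = G.card * 2 ^ g * 2 ^ (m - j) := by ring
    _ ≤ 2 ^ j * 2 ^ (m - j) := by gcongr
    _ = 2 ^ m := by rw [← pow_add, Nat.add_sub_cancel' hj]

/-- Few strings have dense sections. -/
theorem card_dense_section_mul_le {V : ℕ × List Bool → Prop} (hTV : ∀ a t, T (a, t) → V a)
    {k L j g e : ℕ} (hge : 2 * g ≤ e)
    (hV : ∀ F : Finset (List Bool), (∀ w ∈ F, w.length = L + j ∧ V (k, w)) →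
      F.card * 2 ^ e ≤ 2 ^ (L + j))
    {A : Finset ℕ} (hA : ∀ a ∈ A, a < 2 ^ L ∧ ∃ t, 2 ^ j < sectionCount T k L j a t * 2 ^ g) :
    A.card * 2 ^ g ≤ 2 ^ L := by
  classical
  let B : ℕ → Finset ℕ := fun a =>
    (Finset.range (2 ^ j)).filter fun b => V (k, initSeg (a + 2 ^ L * b).testBit (L + j))
  let F : Finset (List Bool) :=
    (A.sigma B).image fun p => initSeg (p.1 + 2 ^ L * p.2).testBit (L + j)
  have hB : ∀ a ∈ A, 2 ^ j ≤ (B a).card * 2 ^ g := by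
    intro a ha
    obtain ⟨-, t, ht⟩ := hA a ha
    refine ht.le.trans (Nat.mul_le_mul_right _ ?_)
    unfold sectionCount
    rw [Nat.count_eq_card_filter_range]
    exact Finset.card_le_card fun b hb => Finset.mem_filter.2
      ⟨(Finset.mem_filter.1 hb).1, hTV _ _ (Finset.mem_filter.1 hb).2⟩
  -- A Markov argument: different pairs give different strings of the sparse set, so `A` is small if
  -- all its sections are large.
  have hF : F.card = ∑ a ∈ A, (B a).card := by
    rw [← Finset.card_sigma]
    refine Finset.card_image_of_injOn ?_
    rintro ⟨a, b⟩ hp ⟨a', b'⟩ hp' h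
    have hp1 := Finset.mem_sigma.1 (Finset.mem_coe.1 hp)
    have hp2 := Finset.mem_sigma.1 (Finset.mem_coe.1 hp')
    have ha := (hA _ hp1.1).1
    have ha' := (hA _ hp2.1).1
    have hb := Finset.mem_range.1 (Finset.mem_filter.1 hp1.2).1
    have hb' := Finset.mem_range.1 (Finset.mem_filter.1 hp2.2).1
    have hlt : ∀ a b, a < 2 ^ L → b < 2 ^ j → a + 2 ^ L * b < 2 ^ (L + j) := by
      intro a b ha hb
      calc a + 2 ^ L * b < 2 ^ L * (b + 1) := by rw [mul_add]; omega
        _ ≤ 2 ^ L * 2 ^ j := Nat.mul_le_mul_left _ hb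
        _ = _ := (pow_add _ _ _).symm
    have h1 := initSeg_testBit_injOn _ (hlt _ _ ha hb) (hlt _ _ ha' hb') h
    have h2 := congrArg (· % 2 ^ L) h1
    have h3 := congrArg (· / 2 ^ L) h1
    simp only [Nat.add_mul_mod_self_left, Nat.mod_eq_of_lt ha, Nat.mod_eq_of_lt ha'] at h2
    simp only [Nat.add_mul_div_left _ _ (Nat.two_pow_pos L), Nat.div_eq_of_lt ha,
      Nat.div_eq_of_lt ha', zero_add] at h3
    subst h2 h3
    rfl
  have h1 := hV F fun w hw => by
    obtain ⟨p, hp, rfl⟩ := Finset.mem_image.1 hw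
    exact ⟨length_initSeg _ _, (Finset.mem_filter.1 (Finset.mem_sigma.1 hp).2).2⟩
  have h2 : A.card * 2 ^ j ≤ F.card * 2 ^ g := by
    rw [hF, Finset.sum_mul, ← smul_eq_mul, ← Finset.sum_const]
    exact Finset.sum_le_sum hB
  have h3 : A.card * 2 ^ g * 2 ^ (j + g) ≤ 2 ^ L * 2 ^ (j + g) := by
    calc A.card * 2 ^ g * 2 ^ (j + g) = A.card * 2 ^ j * 2 ^ (2 * g) := by
          rw [pow_add, two_mul, pow_add]; ring
      _ ≤ F.card * 2 ^ g * 2 ^ e := by gcongr; norm_num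
      _ = F.card * 2 ^ e * 2 ^ g := by ring
      _ ≤ 2 ^ (L + j) * 2 ^ g := by gcongr
      _ = _ := by rw [pow_add, pow_add]; ring
  exact Nat.le_of_mul_le_mul_right h3 (by positivity)

end

end

/-! ### The output is not effectively null for any exponent below `1` -/

/-- Each block outgrows all preceding blocks and every polynomial in the index. -/
theorem exists_blockStart_growth (c C : ℕ) : ∃ l₀, ∀ l, l₀ ≤ l →
    2 * c * (blockStart (l + 1) + C * ((l + 3) * (l + 3)) + 2) ≤ blockStart (l + 2) := by
  refine ⟨2 * c * (9 * C + 3) + 1, fun l hl => ?_⟩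
  set B := 2 ^ ((l + 1) * (l + 1)) with hB
  have h1 : (l + 1) * (l + 1) < B := Nat.lt_two_pow_self
  have h2 : blockStart (l + 1) ≤ B := Nat.sub_le _ _
  -- Quadratic exponents make the ratio of consecutive block starts unbounded, so it beats any
  -- constant `c`.
  have h3 : blockStart (l + 2) = B * 2 ^ (2 * l + 3) - 1 := by
    rw [hB, ← pow_add]; unfold blockStart; congr 2; ring
  have h4 : l < 2 ^ (2 * l + 3) := (by omega : l < 2 * l + 3).trans Nat.lt_two_pow_self
  have h5 : C * ((l + 3) * (l + 3)) ≤ 9 * C * B := by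
    have : (l + 3) * (l + 3) ≤ 9 * ((l + 1) * (l + 1)) := by nlinarith
    nlinarith
  have h6 : 2 * c * (blockStart (l + 1) + C * ((l + 3) * (l + 3)) + 2) + 1 ≤
      B * 2 ^ (2 * l + 3) := by
    calc 2 * c * (blockStart (l + 1) + C * ((l + 3) * (l + 3)) + 2) + 1
        ≤ 2 * c * (B + 9 * C * B + 2 * B) + B := by gcongr <;> omega
      _ = B * (2 * c * (9 * C + 3) + 1) := by ring
      _ ≤ B * 2 ^ (2 * l + 3) := by gcongr; omega
  omega

/-- At stage `o.2`, the value `o.1.2.2` lies in the section of `o.1.2.1`, and this section is still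
sparse. The number `o.1.1` codes the parameters. -/
def sparseStage (T : (ℕ × List Bool) × ℕ → Bool) (o : (ℕ × ℕ × ℕ) × ℕ) : Bool :=
  T ((o.1.1.unpair.1.unpair.1, initSeg (o.1.2.1 +
      2 ^ blockStart (o.1.1.unpair.1.unpair.2 + 2) *
      (o.1.2.2 % 2 ^ o.1.1.unpair.2.unpair.1)).testBit
      (blockStart (o.1.1.unpair.1.unpair.2 + 2) + o.1.1.unpair.2.unpair.1)), o.2) &&
    decide (sectionCount T o.1.1.unpair.1.unpair.1 (blockStart (o.1.1.unpair.1.unpair.2 + 2))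
      o.1.1.unpair.2.unpair.1 o.1.2.1 o.2 * 2 ^ o.1.1.unpair.2.unpair.2 ≤
        2 ^ o.1.1.unpair.2.unpair.1)

/-- At the stage coded by `o.2`, the value `o.1.2.2`, preceded by the blocks coded by `o.2`, has a
dense section. The number `o.1.1` codes the parameters. -/
def denseStage (T : (ℕ × List Bool) × ℕ → Bool) (o : (ℕ × ℕ × ℕ) × ℕ) : Bool :=
  decide (o.2.unpair.1 < 2 ^ blockStart (o.1.1.unpair.1.unpair.2 + 1)) &&
    decide (2 ^ o.1.1.unpair.2.unpair.1 <
      sectionCount T o.1.1.unpair.1.unpair.1 (blockStart (o.1.1.unpair.1.unpair.2 + 2))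
        o.1.1.unpair.2.unpair.1
        (o.2.unpair.1 + 2 ^ blockStart (o.1.1.unpair.1.unpair.2 + 1) * o.1.2.2) o.2.unpair.2 *
          2 ^ o.1.1.unpair.2.unpair.2)

theorem isComputable_sparseStage {T : (ℕ × List Bool) × ℕ → Bool} (hT : IsComputable T) :
    IsComputable (sparseStage T) := by
  refine isComputable_and (by fun_prop) (isComputable_decide_le (isComputable_mul
    (isComputable_sectionCount T hT ?_ ?_ ?_ ?_ ?_) ?_) ?_) <;> fun_prop

theorem isComputable_denseStage {T : (ℕ × List Bool) × ℕ → Bool} (hT : IsComputable T) :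
    IsComputable (denseStage T) := by
  refine isComputable_and (by fun_prop) (isComputable_decide_lt ?_ (isComputable_mul
    (isComputable_sectionCount T hT ?_ ?_ ?_ ?_ ?_) ?_)) <;> fun_prop

section
variable {U : List Bool →. List Bool} {E : ℕ × ℕ × ℕ → ℕ} {x y : BinSeq}

/-- The covered segment may end early in a block, so that this block alone need not account for the
sparsity. The case distinction on its section shifts the sparsity to the preceding block when
necessary. -/
theorem not_effectivelyNull_extract (hU : IsUniversal U) (hE : IsComputable E)
    (hEb : ∀ i, IsBalanced (inputLen i) (blockLen i) fun u v => E (i, u, v))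
    (hElt : ∀ i u v, E (i, u, v) < 2 ^ blockLen i) (hxy : Independent U x y) {c N : ℕ}
    (hx : ∀ n, N ≤ n → ∀ k : ℕ, complexity U (initSeg x n) ≤ k → n ≤ (c + 1) * k)
    (hy : ∀ n, N ≤ n → ∀ k : ℕ, complexity U (initSeg y n) ≤ k → n ≤ (c + 1) * k)
    {s : ℝ} (hs : s < 1) : ¬ EffectivelyNull s (extract E x y) := by
  intro hnull
  obtain ⟨d, V, hd, hV, hVz⟩ := hnull.exists_sparse hs
  obtain ⟨T, hT, hTm, hTV⟩ := exists_stage hV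
  obtain ⟨CB, IB, hB⟩ := exists_density_le hU hE hEb hElt hxy hx hy
    (rePred_exists_stage (isComputable_sparseStage hT))
  obtain ⟨CA, IA, hA⟩ := exists_density_le hU hE hEb hElt hxy hx hy
    (rePred_exists_stage (isComputable_denseStage hT))
  obtain ⟨l₀, hgrow⟩ := exists_blockStart_growth d (5 * (CA + CB))
  -- Since `n` is at least this index, the segment ends in a block late enough for all the
  -- asymptotic bounds. Conversely the index is at most `n`, so its description is short.
  obtain ⟨n, hkn, hzV, hsparse⟩ := hVz (blockStart (l₀ + IA + IB + 2))
  set k := blockStart (l₀ + IA + IB + 2) with hk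
  obtain ⟨l, hl, hL1, hL2⟩ : ∃ l, l₀ + IA + IB ≤ l ∧ blockStart (l + 2) ≤ n ∧
      n < blockStart (l + 3) := by
    obtain ⟨i, hi1, hi2⟩ := exists_blockStart_le n
    have h1 : l₀ + IA + IB + 2 < i + 1 := by
      by_contra h
      have := blockStart_mono (not_lt.1 h)
      omega
    refine ⟨i - 2, by omega, ?_, ?_⟩
    · rwa [show i - 2 + 2 = i by omega]
    · rwa [show i - 2 + 3 = i + 1 by omega]
  set L := blockStart (l + 2) with hL
  set L' := blockStart (l + 1) with hL'
  obtain ⟨j, rfl⟩ := Nat.exists_eq_add_of_le hL1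
  have hLm : L + blockLen (l + 2) = blockStart (l + 3) := blockStart_add_blockLen (l + 2)
  have hLm' : L' + blockLen (l + 1) = L := blockStart_add_blockLen (l + 1)
  have hj : j ≤ blockLen (l + 2) := by omega
  set e := (L + j) / d with he
  -- Half of the sparsity is the threshold for sections, and the other half bounds the density of
  -- the strings with dense sections.
  set g := e / 2 with hg
  have hge : 2 * g ≤ e := Nat.mul_div_le _ _
  set w := (l + 3) * (l + 3) with hw
  have hgL : L' + 5 * (CA + CB) * w + 1 ≤ g := by
    have h1 := hgrow l (by omega)
    rw [hg, Nat.le_div_iff_mul_le two_pos, he, Nat.le_div_iff_mul_le hd]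
    calc (L' + 5 * (CA + CB) * w + 1) * 2 * d
        ≤ 2 * d * (L' + 5 * (CA + CB) * w + 2) := by nlinarith [Nat.zero_le d]
      _ ≤ L := h1
      _ ≤ L + j := Nat.le_add_right _ _
  -- bounds on the parameters
  have hw3 : blockStart (l + 3) < 2 ^ w := by
    have : 0 < 2 ^ w := by positivity
    have h1 : blockStart (l + 3) = 2 ^ w - 1 := rfl
    omega
  have hlw : l + 3 ≤ w := Nat.le_mul_self _
  have hgn : g ≤ L + j := (Nat.div_le_self _ _).trans (Nat.div_le_self _ _)
  let q := Nat.pair (Nat.pair k l) (Nat.pair j g)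
  have hl3 := le_blockStart (l + 3)
  have hq : q < 2 ^ (4 * w) := by
    have h1 := natPair_lt_two_pow (natPair_lt_two_pow (a := k) (b := l) (s := w) (by omega)
      (by omega)) (natPair_lt_two_pow (a := j) (b := g) (s := w) (by omega) (by omega))
    rwa [← mul_assoc] at h1
  have hl4 : l + 3 < 2 ^ (4 * w) :=
    Nat.lt_of_le_of_lt (by omega) (Nat.lt_two_pow_self (n := 4 * w))
  have hin : inputLen (l + 2) < 2 ^ (4 * w) :=
    Nat.pow_lt_pow_right (by norm_num) (by
      have : (l + 2 + 1) * (l + 2 + 1) = w := rfl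
      rw [this]; omega)
  have hw1 : 1 ≤ w := by omega
  -- The contradiction in both cases: all parameters are below `2 ^ (4 * w)`, so `exists_density_le`
  -- allows only `C * (4 * w + 1)`. Here `p` is the loss from forgetting earlier blocks.
  have hlt : ∀ p q C : ℕ, p + 5 * C * w < q → ¬ q - p ≤ C * (4 * w + 1) := by
    intro p q C h1 h2
    have : C * (4 * w + 1) ≤ 5 * C * w := by nlinarith [Nat.mul_le_mul_left C hw1]
    omega
  have hmonoA : 5 * CA * w ≤ 5 * (CA + CB) * w := by gcongr; omega
  have hmonoB : 5 * CB * w ≤ 5 * (CA + CB) * w := by gcongr; omega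
  have hz1 : prefixCode (extract E x y) L = outPrefix E (l + 2) (prefixCode x (inputLen (l + 2)))
      (prefixCode y (inputLen (l + 2))) :=
    prefixCode_extract hElt x y fun i hi => inputLen_mono (by omega)
  by_cases hdense : ∃ t, 2 ^ j < sectionCount T k L j (prefixCode (extract E x y) L) t * 2 ^ g
  · -- the preceding block already lies in a sparse set
    refine hlt L' g CA (by omega) (hA l q (g - L') (4 * w) (by omega) (by omega) hq
      ((inputLen_mono (by omega)).trans_lt hin) (fun a => ?_) ?_)
    · classical
      let A := (Finset.range (2 ^ L)).filter fun a =>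
        ∃ t, 2 ^ j < sectionCount T k L j a t * 2 ^ g
      have hAc : A.card * 2 ^ g ≤ 2 ^ L :=
        card_dense_section_mul_le (fun a t h => (hTV a).2 ⟨t, h⟩) hge hsparse fun a ha =>
          ⟨Finset.mem_range.1 (Finset.mem_filter.1 ha).1, (Finset.mem_filter.1 ha).2⟩
      -- Dropping the first `L'` bits leaves the block itself. Allowing every prefix of length `L'`
      -- raises the density by at most `2 ^ L'`, hence the exponent `g - L'`.
      refine ⟨A.image (· / 2 ^ L'), fun b hb => ?_, ?_⟩
      · rintro ⟨t, h1⟩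
        simp only [denseStage, q, Nat.unpair_pair, Bool.and_eq_true, decide_eq_true_eq] at h1
        refine Finset.mem_image.2 ⟨t.unpair.1 + 2 ^ L' * b, Finset.mem_filter.2
          ⟨Finset.mem_range.2 ?_, t.unpair.2, h1.2⟩, ?_⟩
        · calc t.unpair.1 + 2 ^ L' * b < 2 ^ L' * (b + 1) := by
                rw [mul_add, mul_one, add_comm]; exact Nat.add_lt_add_left h1.1 _
            _ ≤ 2 ^ L' * 2 ^ blockLen (l + 1) := Nat.mul_le_mul_left _ hb
            _ = 2 ^ L := by rw [← pow_add, hLm']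
        · rw [Nat.add_mul_div_left _ _ (Nat.two_pow_pos _), Nat.div_eq_of_lt h1.1, zero_add]
      · refine Nat.le_of_mul_le_mul_right (c := 2 ^ L') ?_ (by positivity)
        calc _ ≤ A.card * 2 ^ (g - L') * 2 ^ L' := 
              Nat.mul_le_mul_right _ (Nat.mul_le_mul_right _ Finset.card_image_le)
          _ = A.card * 2 ^ g := by rw [mul_assoc, ← pow_add, Nat.sub_add_cancel (by omega)]
          _ ≤ 2 ^ L := hAc
          _ = _ := by rw [← pow_add, add_comm, hLm']
    · obtain ⟨t, ht⟩ := hdense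
      refine ⟨Nat.pair (prefixCode (extract E x y) L') t, ?_⟩
      simp only [denseStage, q, Nat.unpair_pair, Bool.and_eq_true, decide_eq_true_eq]
      refine ⟨prefixCode_lt _ _, ?_⟩
      have h1 := prefixCode_extract_add (E := E) x y (i := l + 1) le_rfl
      rw [hLm', Nat.mod_eq_of_lt (hElt _ _ _)] at h1
      rwa [← h1]
  · -- the current block lies in a sparse section
    push Not at hdense
    refine hlt 0 g CB (by omega) (hB (l + 1) q (g - 0) (4 * w) (by omega) (by omega) hq hin
      (fun a => ?_) ?_)
    · obtain ⟨F, hF1, hF2⟩ := exists_finset_section (L := L) (k := k) (g := g) hTm hj a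
      refine ⟨F, fun b hb => ?_, hF2⟩
      rintro ⟨t, h1⟩
      simp only [sparseStage, q, Nat.unpair_pair, Bool.and_eq_true, decide_eq_true_eq] at h1
      exact hF1 b hb ⟨t, h1⟩
    · obtain ⟨t, ht⟩ := (hTV _).1 hzV
      refine ⟨t, ?_⟩
      simp only [sparseStage, q, Nat.unpair_pair, Bool.and_eq_true, decide_eq_true_eq]
      rw [← hz1]
      -- The section never becomes dense, so in particular it is still sparse when the segment of
      -- the output appears.
      refine ⟨?_, hdense t⟩
      rw [← prefixCode_extract_add x y hj, initSeg_prefixCode]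
      exact ht

/-- One reduction increases every positive dimension to `1`. -/
theorem exists_extractor (hU : IsUniversal U) :
    ∃ (f : BinSeq → BinSeq → BinSeq) (M : OracleCode),
      (∀ x y n, M.eval x y n = Part.some (f x y n).toNat) ∧
      ∀ τ : ℝ, 0 < τ → ∀ x y : BinSeq, Independent U x y →
        τ ≤ constructiveDim x → τ ≤ constructiveDim y → constructiveDim (f x y) = 1 := by
  obtain ⟨E, hE, hE'⟩ := exists_isComputable_isBalanced isComputable_inputLen isComputable_blockLen
  obtain ⟨M, hM⟩ := OracleCode.exists_eval_eq_apply_prefixCode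
    (N := fun p => inputLen (blockOf p)) (by fun_prop)
    (g := fun a => (E (blockOf a.1, a.2.1, a.2.2)).testBit (a.1 - blockStart (blockOf a.1)))
    (by fun_prop)
  refine ⟨extract E, M, hM, fun τ hτ x y hxy hx hy => ?_⟩
  obtain ⟨c₁, N₁, h1⟩ := exists_le_mul_complexity hU hτ hx
  obtain ⟨c₂, N₂, h2⟩ := exists_le_mul_complexity hU hτ hy
  refine le_antisymm (constructiveDim_le_one _) (one_le_constructiveDim fun s hs =>
    not_effectivelyNull_extract hU hE (fun i => (hE' i).2) (fun i => (hE' i).1) hxy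
      (c := c₁ + c₂) (N := N₁ + N₂) (fun n hn k hk => ?_) (fun n hn k hk => ?_) hs)
  · exact (h1 n (by omega) k hk).trans (Nat.mul_le_mul_right _ (by omega))
  · exact (h2 n (by omega) k hk).trans (Nat.mul_le_mul_right _ (by omega))

end

end TwoSources

theorem mainTheorem2 (U : List Bool →. List Bool) (hU : TwoSources.IsUniversal U) :
    (∀ τ : ℝ, 0 < τ →
      ∃ f : TwoSources.BinSeq → TwoSources.BinSeq → TwoSources.BinSeq,
        TwoSources.IsTruthTableReduction f ∧
        ∀ x y : TwoSources.BinSeq, TwoSources.Independent U x y →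
          τ ≤ TwoSources.constructiveDim x → τ ≤ TwoSources.constructiveDim y →
          TwoSources.constructiveDim (f x y) = 1) ∧
    (∃ f : ℚ → TwoSources.BinSeq → TwoSources.BinSeq → TwoSources.BinSeq,
        TwoSources.IsUniformTruthTableReduction f ∧
        ∀ τ : ℚ, 0 < τ →
          ∀ x y : TwoSources.BinSeq, TwoSources.Independent U x y →
            (τ : ℝ) ≤ TwoSources.constructiveDim x → (τ : ℝ) ≤ TwoSources.constructiveDim y →
            TwoSources.constructiveDim (f τ x y) = 1) := by
  obtain ⟨f, M, hM, hf⟩ := TwoSources.exists_extractor hU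
  exact ⟨fun τ hτ => ⟨f, TwoSources.isTruthTableReduction_of_eval_eq hM, hf τ hτ⟩,
    fun _ => f, TwoSources.isUniformTruthTableReduction_of_eval_eq hM,
    fun τ hτ => hf τ (by exact_mod_cast hτ)⟩
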